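/- Let $X$ be a set of datasets with a relation "neighbouring" such that some two distinct datasets are neighbouring. A mechanism $M$ on $X$ assigns to every $x\in X$ a random outcome $M(x)$ in a measurable space; it is $(\varepsilon,\delta)$-DP if $\Pr[M(x)\in S]\le e^{\varepsilon}\Pr[M(x')\in S]+\delta$ for all neighbouring $x,x'$ and all measurable $S$, and $\delta_{\mathrm{opt}}(M,\varepsilon)=\inf\{\delta : M \text{ is } (\varepsilon,\delta)\text{-DP}\}$. For a class $\mathcal M$ of mechanisms, $\delta_{\mathrm{opt}}(\mathcal M,\varepsilon)=\sup_{M\in\mathcal M}\delta_{\mathrm{opt}}(M,\varepsilon)$. A mechanism $M$ is $\varepsilon$-bounded-range ($\varepsilon$-BR) if for all neighbouring $x,x'$ the laws of $M(x)$ and $M(x')$ have probability mass functions or densities $f,f'$ with respect to a common measure such that $\frac{f(y_1)}{f'(y_1)}\le e^{\varepsilon}\frac{f(y_2)}{f'(y_2)}$, i.e. $f(y_1)f'(y_2)\le e^{\varepsilon}f(y_2)f'(y_1)$, for all outcomes $y_1,y_2$. For $k\in\mathbb N$ and $\varepsilon\ge 0$ let $\mathcal M_{\mathrm{BR}}^k$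 be the class of all mechanisms $M_1\times\cdots\times M_k$, $x\mapsto(M_1(x),\dots,M_k(x))$ with independent components, where every $M_i$ is $\varepsilon$-BR. For $t\in[0,\varepsilon]$ put $p_t=\frac{e^{-t}-e^{-\varepsilon}}{1-e^{-\varepsilon}}$ (with $p_0=1$ if $\varepsilon=0$). For $\varepsilon_g\in\mathbb R$ and $0\le\ell\le k$ let $t_\ell^*$ be the point of $[0,\varepsilon]$ closest to $\frac{\varepsilon_g+(\ell+1)\varepsilon}{k+1}$. Then for all $k\in\mathbb N$, $\varepsilon\ge0$ and $\varepsilon_g\in\mathbb R$, $$\delta_{\mathrm{opt}}(\mathcal M_{\mathrm{BR}}^k,\varepsilon_g)=\max_{0\le\ell\le k}\ \sum_{i=0}^k\binom ki\,p_{t_\ell^*}^{\,k-i}(1-p_{t_\ell^*})^{i}\,\max\left\{e^{k t_\ell^*-i\varepsilon}-e^{\varepsilon_g},\,0\right\}.$$ Furthermore, this value can be computed in $O(k^2)$ time: there are a single program for a machine with finitely many real registers, whose unit-cost steps are loading an integer constant, copying, $+$, $-$, $\times$, $\div$, $\exp$ and comparison of real numbers, and a constant $C$, such that for all $k\ge1$,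 $\varepsilon\ge0$ and $\varepsilon_g\in\mathbb R$ the program, started on $(k,\varepsilon,\varepsilon_g)$, halts after at most $Ck^2$ steps and outputs this value. -/

import Mathlib

open MeasureTheory
open scoped NNReal ENNReal

universe u v

/-! ## Mechanisms, differential privacy, bounded range -/

/-- A randomized mechanism with datasets in `X`: a measurable outcome space, and for every dataset
the law of the outcome. Discrete and continuous outcome spaces are both covered. -/
structure Mechanism (X : Type v) where
  /-- the outcome space -/
  Out : Type u
  [measurableSpace : MeasurableSpace Out]
  /-- `law x` is the distribution of the outcome on the dataset `x` -/
  law : X → Measure Out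
  [isProb : ∀ x, IsProbabilityMeasure (law x)]

attribute [instance] Mechanism.measurableSpace Mechanism.isProb

namespace Mechanism

variable {X : Type v}

/-- `M` is `(ε, δ)`-differentially private for the neighbouring relation `nbr`. -/
def IsDP (nbr : X → X → Prop) (M : Mechanism.{u} X) (ε δ : ℝ) : Prop :=
  ∀ x x' : X, nbr x x' → ∀ S : Set M.Out, MeasurableSet S →
    (M.law x).real S ≤ Real.exp ε * (M.law x').real S + δ

/-- `M` is `ε`-bounded-range for the neighbouring relation `nbr`: for neighbours `x`, `x'` the laws
of `M(x)` and `M(x')` have densities `f`, `f'` (probability mass functions if `μ` is a counting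
measure, probability density functions if `μ` is a Lebesgue measure) with
`f y₁ / f' y₁ ≤ e ^ ε * (f y₂ / f' y₂)` for all outcomes `y₁`, `y₂`. The denominators are cleared,
so that outcomes with `f y = f' y = 0`, whose ratio is meaningless, impose no condition; since `f`
and `f'` have total mass one, the cleared form forces `f y = 0 ↔ f' y = 0`. -/
def IsBR (nbr : X → X → Prop) (M : Mechanism.{u} X) (ε : ℝ) : Prop :=
  ∀ x x' : X, nbr x x' →
    ∃ (μ : Measure M.Out) (f f' : M.Out → ℝ≥0), SigmaFinite μ ∧ Measurable f ∧ Measurable f' ∧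
      M.law x = μ.withDensity (fun y => (f y : ℝ≥0∞)) ∧
      M.law x' = μ.withDensity (fun y => (f' y : ℝ≥0∞)) ∧
      ∀ y₁ y₂ : M.Out, (f y₁ : ℝ) * f' y₂ ≤ Real.exp ε * (f y₂ * f' y₁)

/-- The composed mechanism `M₁ × ⋯ × M_k`: it runs all the mechanisms on the same dataset, with
independent randomness, and releases all the outcomes. -/
noncomputable def prod {k : ℕ} (M : Fin k → Mechanism.{u} X) : Mechanism.{u} X where
  Out := ∀ i, (M i).Out
  law x := Measure.pi fun i => (M i).law x

/-- The optimal `δ` of a mechanism at `ε`: the infimum of all `δ` such that `M` is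
`(ε, δ)`-differentially private. -/
noncomputable def deltaOpt (nbr : X → X → Prop) (M : Mechanism.{u} X) (ε : ℝ) : ℝ :=
  sInf {δ : ℝ | M.IsDP nbr ε δ}

/-- The optimal `δ` of a class of mechanisms at `ε`: the supremum of the optimal `δ` of its
members. -/
noncomputable def deltaOptClass (nbr : X → X → Prop) (C : Set (Mechanism.{u} X)) (ε : ℝ) : ℝ :=
  sSup ((fun M => M.deltaOpt nbr ε) '' C)

/-- The class of the products `M₁ × ⋯ × M_k` of `k` mechanisms that are all `ε`-bounded-range. -/
def nonadaptiveBR (nbr : X → X → Prop) (k : ℕ) (ε : ℝ) : Set (Mechanism.{u} X) :=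
  {M | ∃ N : Fin k → Mechanism.{u} X, (∀ i, (N i).IsBR nbr ε) ∧ M = prod N}

/-! The infimum and the supremum above are genuine as soon as there are neighbours. -/

theorem isDP_one (nbr : X → X → Prop) (M : Mechanism.{u} X) (ε : ℝ) : M.IsDP nbr ε 1 := by
  intro x x' _ S _
  have h1 : (M.law x).real S ≤ 1 := measureReal_le_one
  have h2 : 0 ≤ Real.exp ε * (M.law x').real S := by positivity
  linarith

theorem IsDP.nonneg {nbr : X → X → Prop} (hnbr : ∃ x x', nbr x x') {M : Mechanism.{u} X}
    {ε δ : ℝ} (h : M.IsDP nbr ε δ) : 0 ≤ δ := by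
  obtain ⟨x, x', hx⟩ := hnbr
  simpa using h x x' hx ∅ MeasurableSet.empty

theorem isGLB_deltaOpt {nbr : X → X → Prop} (hnbr : ∃ x x', nbr x x') (M : Mechanism.{u} X)
    (ε : ℝ) : IsGLB {δ : ℝ | M.IsDP nbr ε δ} (M.deltaOpt nbr ε) :=
  isGLB_csInf ⟨1, isDP_one nbr M ε⟩ ⟨0, fun _ h => IsDP.nonneg hnbr h⟩

theorem nonadaptiveBR_nonempty (nbr : X → X → Prop) (k : ℕ) {ε : ℝ} (hε : 0 ≤ ε) :
    (nonadaptiveBR.{u} nbr k ε).Nonempty := by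
  let T : Mechanism.{u} X := { Out := PUnit, law := fun _ => Measure.dirac PUnit.unit }
  refine ⟨prod fun _ => T, fun _ => T, fun _ x x' _ => ?_, rfl⟩
  refine ⟨Measure.dirac PUnit.unit, fun _ => 1, fun _ => 1, inferInstance, measurable_const,
    measurable_const, ?_, ?_, fun _ _ => ?_⟩
  · simp [T]
  · simp [T]
  · simpa using hε

theorem isLUB_deltaOptClass {nbr : X → X → Prop} (hnbr : ∃ x x', nbr x x') (k : ℕ) {ε : ℝ}
    (hε : 0 ≤ ε) (εg : ℝ) :
    IsLUB ((fun M => M.deltaOpt nbr εg) '' nonadaptiveBR.{u} nbr k ε)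
      (deltaOptClass nbr (nonadaptiveBR.{u} nbr k ε) εg) := by
  refine isLUB_csSup ((nonadaptiveBR_nonempty nbr k hε).image _) ⟨1, ?_⟩
  rintro _ ⟨M, -, rfl⟩
  exact (isGLB_deltaOpt hnbr M εg).1 (isDP_one nbr M εg)

end Mechanism

/-! ## The explicit formula -/

/-- The probability `p_{ε,t}` that generalized random response with parameters `ε` and `t`
answers `0` on input `1`. For `ε = 0` (and hence `t = 0`) the fraction reads `0 / 0`, and the value
is set to `1`, which is the value of `p_{ε,0}` for all `ε > 0`. -/
noncomputable def grrP (ε t : ℝ) : ℝ :=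
  if ε = 0 then 1 else (Real.exp (-t) - Real.exp (-ε)) / (1 - Real.exp (-ε))

/-- The candidate `t*_ℓ = (ε_g + (ℓ + 1) ε) / (k + 1)`, rounded to the closest point of `[0, ε]`. -/
noncomputable def tStar (k : ℕ) (ε εg : ℝ) (ℓ : ℕ) : ℝ :=
  max 0 (min ε ((εg + (ℓ + 1) * ε) / (k + 1)))

/-- The binomial sum
`∑_{i=0}^k C(k,i) p_t^{k-i} (1-p_t)^i max {e^{k t - i ε} - e^{ε_g}, 0}`. -/
noncomputable def binomialDelta (k : ℕ) (ε εg t : ℝ) : ℝ :=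
  ∑ i ∈ Finset.range (k + 1), (k.choose i : ℝ) * grrP ε t ^ (k - i) * (1 - grrP ε t) ^ i *
    max (Real.exp (k * t - i * ε) - Real.exp εg) 0

/-! ## A real-number machine with a step count -/

/-- Programs of a machine with real-valued registers `R 0, R 1, …`, of which a program can mention
only finitely many. There is no way to store a real constant other than an integer. -/
inductive RealProg : Type
  /-- `R r := n` -/
  | const (r : ℕ) (n : ℤ)
  /-- `R r := R a` -/
  | copy (r a : ℕ)
  /-- `R r := R a + R b` -/
  | add (r a b : ℕ)
  /-- `R r := R a - R b` -/
  | sub (r a b : ℕ)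
  /-- `R r := R a * R b` -/
  | mul (r a b : ℕ)
  /-- `R r := R a / R b`; the machine is stuck if `R b = 0` -/
  | div (r a b : ℕ)
  /-- `R r := exp (R a)` -/
  | exp (r a : ℕ)
  /-- first `c`, then `d` -/
  | seq (c d : RealProg)
  /-- `if R a ≤ R b then c else d` -/
  | ifLe (a b : ℕ) (c d : RealProg)
  /-- `while R a ≤ R b do c` -/
  | whileLe (a b : ℕ) (c : RealProg)

namespace RealProg

/-- `Runs c s s' n`: started with register contents `s`, the program `c` halts after exactly `n`
steps with register contents `s'`. Every assignment and every evaluation of a test is one step. -/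
inductive Runs : RealProg → (ℕ → ℝ) → (ℕ → ℝ) → ℕ → Prop
  | const (r : ℕ) (n : ℤ) (s : ℕ → ℝ) :
      Runs (.const r n) s (Function.update s r (n : ℝ)) 1
  | copy (r a : ℕ) (s : ℕ → ℝ) : Runs (.copy r a) s (Function.update s r (s a)) 1
  | add (r a b : ℕ) (s : ℕ → ℝ) : Runs (.add r a b) s (Function.update s r (s a + s b)) 1
  | sub (r a b : ℕ) (s : ℕ → ℝ) : Runs (.sub r a b) s (Function.update s r (s a - s b)) 1
  | mul (r a b : ℕ) (s : ℕ → ℝ) : Runs (.mul r a b) s (Function.update s r (s a * s b)) 1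
  | div (r a b : ℕ) (s : ℕ → ℝ) (h : s b ≠ 0) :
      Runs (.div r a b) s (Function.update s r (s a / s b)) 1
  | exp (r a : ℕ) (s : ℕ → ℝ) : Runs (.exp r a) s (Function.update s r (Real.exp (s a))) 1
  | seq {c d : RealProg} {s s' s'' : ℕ → ℝ} {m n : ℕ} (hc : Runs c s s' m)
      (hd : Runs d s' s'' n) : Runs (.seq c d) s s'' (m + n)
  | ifTrue {a b : ℕ} {c d : RealProg} {s s' : ℕ → ℝ} {n : ℕ} (h : s a ≤ s b)
      (hc : Runs c s s' n) : Runs (.ifLe a b c d) s s' (n + 1)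
  | ifFalse {a b : ℕ} {c d : RealProg} {s s' : ℕ → ℝ} {n : ℕ} (h : ¬ s a ≤ s b)
      (hd : Runs d s s' n) : Runs (.ifLe a b c d) s s' (n + 1)
  | whileTrue {a b : ℕ} {c : RealProg} {s s' s'' : ℕ → ℝ} {m n : ℕ} (h : s a ≤ s b)
      (hc : Runs c s s' m) (hw : Runs (.whileLe a b c) s' s'' n) :
      Runs (.whileLe a b c) s s'' (m + n + 1)
  | whileFalse {a b : ℕ} {c : RealProg} {s : ℕ → ℝ} (h : ¬ s a ≤ s b) :
      Runs (.whileLe a b c) s s 1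

/-- The machine is deterministic, so that the result and the running time of a halting program are
well defined. -/
theorem Runs.unique {c : RealProg} {s s₁ s₂ : ℕ → ℝ} {n₁ n₂ : ℕ} (h₁ : Runs c s s₁ n₁)
    (h₂ : Runs c s s₂ n₂) : s₁ = s₂ ∧ n₁ = n₂ := by
  induction h₁ generalizing s₂ n₂ with
  | seq _ _ ihc ihd =>
    cases h₂ with
    | seq hc' hd' =>
      obtain ⟨rfl, rfl⟩ := ihc hc'
      obtain ⟨rfl, rfl⟩ := ihd hd'
      exact ⟨rfl, rfl⟩
  | ifTrue h _ ih =>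
    cases h₂ with
    | ifTrue _ h' => obtain ⟨rfl, rfl⟩ := ih h'; exact ⟨rfl, rfl⟩
    | ifFalse h' _ => exact absurd h h'
  | ifFalse h _ ih =>
    cases h₂ with
    | ifTrue h' _ => exact absurd h' h
    | ifFalse _ h' => obtain ⟨rfl, rfl⟩ := ih h'; exact ⟨rfl, rfl⟩
  | whileTrue h _ _ ihc ihw =>
    cases h₂ with
    | whileTrue _ hc' hw' =>
      obtain ⟨rfl, rfl⟩ := ihc hc'
      obtain ⟨rfl, rfl⟩ := ihw hw'
      exact ⟨rfl, rfl⟩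
    | whileFalse h' => exact absurd h h'
  | whileFalse h =>
    cases h₂ with
    | whileTrue h' _ _ => exact absurd h' h
    | whileFalse _ => exact ⟨rfl, rfl⟩
  | _ => cases h₂; exact ⟨rfl, rfl⟩

/-- The initial register contents: the three inputs in `R 0`, `R 1`, `R 2`, and `0` elsewhere. -/
def input (a b c : ℝ) : ℕ → ℝ
  | 0 => a
  | 1 => b
  | 2 => c
  | _ => 0

end RealProg

/-! ## Generalized random response as an operator on functions -/

/-! Among bounded-range pairs with a given range of likelihood ratios, two-point generalized random
response (GRR) is the worst, so the problem reduces to choosing its parameters.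

Upper bound. Fix neighbours, with laws `P i`, `Q i` in component `i`. The bounded-range condition
confines `dP/dQ` to some window `[e^(t-ε), e^t]` with `t ∈ [0, ε]` (`exists_boundedRange_ratio`).
The quantity to bound is `P(S) - c Q(S)` for product measures, with `c = e^εg`. Peeling off one
component replaces a convex bound `φ(a)` by an average of `φ(a L)` over a ratio `L` of mean 1 in the
window; the chord of `φ` shows that this average is largest when `L` sits at the two endpoints,
which is GRR with parameter `t` (`prod_sub_le_grrStep`). Hence `k` operators `grrStep ε t`, applied
to `x ↦ max (x - c) 0`, bound the product.

These operators commute, and moving two parameters towards each other with fixed sum only increases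
the result (`grrStep_grrStep_le`), so all parameters may be replaced by their mean. What remains is
`binomialDelta` at a common `t`. The positive parts select an initial segment of the sum, so
`binomialDelta` coincides at `t` with some partial signed sum `thresholdDelta` (or vanishes) and
dominates all of them on `[0, ε]`. The derivative of the `ℓ`-th partial sum telescopes to a
nonnegative factor times `e^εg - e^((k+1)t - (ℓ+1)ε)`; therefore its maximum lies at `tStar`, and
only `k + 1` candidates survive.

Lower bound. GRR is itself bounded-range, and the set where its likelihood ratio is at least `c`
attains `binomialDelta`.

Running time. Each candidate sum takes linearly many operations by a Horner scheme with updated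
binomial weights. -/

theorem grrP_of_pos {ε : ℝ} (hε : 0 < ε) (t : ℝ) :
    grrP ε t = (Real.exp (-t) - Real.exp (-ε)) / (1 - Real.exp (-ε)) := by
  simp [grrP, hε.ne']

theorem one_sub_exp_neg_pos {ε : ℝ} (hε : 0 < ε) : 0 < 1 - Real.exp (-ε) := by
  have : Real.exp (-ε) < 1 := by rw [← Real.exp_zero]; exact Real.exp_lt_exp.2 (by linarith)
  linarith

theorem one_sub_grrP_of_pos {ε : ℝ} (hε : 0 < ε) (t : ℝ) :
    1 - grrP ε t = (1 - Real.exp (-t)) / (1 - Real.exp (-ε)) := by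
  have := one_sub_exp_neg_pos hε
  rw [grrP_of_pos hε]
  field_simp
  ring

theorem grrP_nonneg {ε t : ℝ} (ht : t ∈ Set.Icc 0 ε) : 0 ≤ grrP ε t := by
  rcases (ht.1.trans ht.2).eq_or_lt with h | h
  · simp [grrP, ← h]
  · rw [grrP_of_pos h]
    have : Real.exp (-ε) ≤ Real.exp (-t) := Real.exp_le_exp.2 (by linarith [ht.2])
    exact div_nonneg (by linarith) (one_sub_exp_neg_pos h).le

theorem one_sub_grrP_nonneg {ε t : ℝ} (ht : t ∈ Set.Icc 0 ε) : 0 ≤ 1 - grrP ε t := by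
  rcases (ht.1.trans ht.2).eq_or_lt with h | h
  · simp [grrP, ← h]
  · rw [one_sub_grrP_of_pos h]
    have : Real.exp (-t) ≤ 1 := Real.exp_le_one_iff.2 (by linarith [ht.1])
    exact div_nonneg (by linarith) (one_sub_exp_neg_pos h).le

/-- The expectation of `φ (x * R)`, where `R` is the likelihood ratio of generalized random
response with parameters `ε` and `t`. -/
noncomputable def grrStep (ε t : ℝ) (φ : ℝ → ℝ) (x : ℝ) : ℝ :=
  grrP ε t * φ (x * Real.exp t) + (1 - grrP ε t) * φ (x * Real.exp (t - ε))

/-- Likelihood ratios of independent responses multiply, so their order is irrelevant. This makes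
folds over multisets meaningful, where any two parameters can be brought to the front. -/
instance grrStep_leftCommutative (ε : ℝ) : LeftCommutative (grrStep ε) where
  left_comm t t' φ := by
    funext x
    simp only [grrStep]
    rw [mul_right_comm x (Real.exp t) (Real.exp t'),
      mul_right_comm x (Real.exp t) (Real.exp (t' - ε)),
      mul_right_comm x (Real.exp (t - ε)) (Real.exp t'),
      mul_right_comm x (Real.exp (t - ε)) (Real.exp (t' - ε))]
    ring

theorem grrStep_mono {ε t : ℝ} (ht : t ∈ Set.Icc 0 ε) {φ ψ : ℝ → ℝ}
    (h : ∀ x, 0 ≤ x → φ x ≤ ψ x) {x : ℝ} (hx : 0 ≤ x) : grrStep ε t φ x ≤ grrStep ε t ψ x :=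
  add_le_add (mul_le_mul_of_nonneg_left (h _ (by positivity)) (grrP_nonneg ht))
    (mul_le_mul_of_nonneg_left (h _ (by positivity)) (one_sub_grrP_nonneg ht))

theorem ConvexOn.comp_mul_const_Ici {φ : ℝ → ℝ} (hφ : ConvexOn ℝ (Set.Ici 0) φ) {r : ℝ}
    (hr : 0 ≤ r) : ConvexOn ℝ (Set.Ici 0) fun x => φ (x * r) := by
  refine ⟨convex_Ici 0, fun x hx y hy a b ha hb hab => ?_⟩
  have := hφ.2 (mul_nonneg hx hr : 0 ≤ x * r) (mul_nonneg hy hr : 0 ≤ y * r) ha hb hab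
  simp only [smul_eq_mul] at this ⊢
  rwa [show (a * x + b * y) * r = a * (x * r) + b * (y * r) by ring]

theorem convexOn_grrStep {ε t : ℝ} (ht : t ∈ Set.Icc 0 ε) {φ : ℝ → ℝ}
    (hφ : ConvexOn ℝ (Set.Ici 0) φ) : ConvexOn ℝ (Set.Ici 0) (grrStep ε t φ) :=
  ((hφ.comp_mul_const_Ici (Real.exp_pos t).le).smul (grrP_nonneg ht)).add
    ((hφ.comp_mul_const_Ici (Real.exp_pos (t - ε)).le).smul (one_sub_grrP_nonneg ht))

theorem convexOn_foldr_grrStep {ε : ℝ} {φ : ℝ → ℝ} (hφ : ConvexOn ℝ (Set.Ici 0) φ)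
    (s : Multiset ℝ) (hs : ∀ t ∈ s, t ∈ Set.Icc 0 ε) :
    ConvexOn ℝ (Set.Ici 0) (s.foldr (grrStep ε) φ) := by
  induction s using Multiset.induction_on with
  | empty => simpa using hφ
  | cons t s ih =>
    rw [Multiset.foldr_cons]
    exact convexOn_grrStep (hs t (Multiset.mem_cons_self t s))
      (ih fun t' h' => hs t' (Multiset.mem_cons_of_mem h'))

theorem convexOn_max_sub (c : ℝ) : ConvexOn ℝ (Set.Ici 0) fun x : ℝ => max (x - c) 0 :=
  ((convexOn_id (convex_Ici 0)).add_const (-c)).sup (convexOn_const 0 (convex_Ici 0))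

/-- Pascal's rule; `i` counts the responses whose ratio is `e^(t-ε)` instead of `e^t`. -/
theorem iterate_grrStep_apply (ε t : ℝ) (φ : ℝ → ℝ) (k : ℕ) (x : ℝ) :
    (grrStep ε t)^[k] φ x = ∑ i ∈ Finset.range (k + 1), (k.choose i : ℝ) *
      (grrP ε t ^ (k - i) * (1 - grrP ε t) ^ i * φ (x * Real.exp (k * t - i * ε))) := by
  induction k generalizing x with
  | zero => simp
  | succ n ih =>
    rw [Function.iterate_succ_apply', grrStep, ih, ih]
    have key := Finset.sum_choose_succ_mul (fun i j : ℕ => grrP ε t ^ j * (1 - grrP ε t) ^ i *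
      φ (x * Real.exp ((n + 1 : ℕ) * t - i * ε))) n
    rw [key, Finset.mul_sum, Finset.mul_sum]
    congr 1 <;> refine Finset.sum_congr rfl fun i hi => ?_
    · rw [Nat.succ_sub (by simpa [Nat.lt_succ_iff] using hi), pow_succ, mul_assoc x,
        ← Real.exp_add, show t + (n * t - i * ε) = (n + 1 : ℕ) * t - i * ε by push_cast; ring]
      ring
    · rw [pow_succ (1 - grrP ε t), mul_assoc x, ← Real.exp_add,
        show t - ε + (n * t - i * ε) = (n + 1 : ℕ) * t - (i + 1 : ℕ) * ε by push_cast; ring]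
      ring

theorem binomialDelta_eq_iterate (k : ℕ) (ε εg t : ℝ) :
    binomialDelta k ε εg t = (grrStep ε t)^[k] (fun x => max (x - Real.exp εg) 0) 1 := by
  simp only [binomialDelta, iterate_grrStep_apply, one_mul, mul_assoc]

/-! ## Averaging the parameters -/

/-- With `a + b` fixed, two responses always produce the same three ratios; only their weights
change. Moving the parameters together preserves the product of `e^(-a)` and `e^(-b)` and lowers
their sum, which shifts weight from the middle ratio to the outer two. Convexity makes this shift
favourable. -/
theorem grrStep_grrStep_le {ε a b m : ℝ} (hε : 0 < ε) (ham : a ≤ m) (hmb : m ≤ b)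
    {φ : ℝ → ℝ} (hφ : ConvexOn ℝ (Set.Ici 0) φ) {x : ℝ} (hx : 0 ≤ x) :
    grrStep ε a (grrStep ε b φ) x ≤ grrStep ε m (grrStep ε (a + b - m) φ) x := by
  have hα := Real.exp_pos (-ε)
  have h1 := one_sub_exp_neg_pos hε
  have expand : ∀ t t', t + t' = a + b → grrStep ε t (grrStep ε t' φ) x =
      grrP ε t * grrP ε t' * φ (x * Real.exp (a + b)) +
      (grrP ε t * (1 - grrP ε t') + (1 - grrP ε t) * grrP ε t') *
        φ (x * Real.exp (a + b - ε)) +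
      (1 - grrP ε t) * (1 - grrP ε t') * φ (x * Real.exp (a + b - ε - ε)) := by
    intro t t' h
    simp only [grrStep, mul_assoc x, ← Real.exp_add]
    rw [show t + t' = a + b from h, show t + (t' - ε) = a + b - ε by linarith,
      show t - ε + t' = a + b - ε by linarith,
      show t - ε + (t' - ε) = a + b - ε - ε by linarith]
    ring
  rw [expand a b rfl, expand m (a + b - m) (by ring)]
  have conv : (1 + Real.exp (-ε)) * φ (x * Real.exp (a + b - ε)) ≤
      Real.exp (-ε) * φ (x * Real.exp (a + b)) + φ (x * Real.exp (a + b - ε - ε)) := by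
    have := hφ.2 (Set.mem_Ici.2 (by positivity : 0 ≤ x * Real.exp (a + b)))
      (Set.mem_Ici.2 (by positivity : 0 ≤ x * Real.exp (a + b - ε - ε)))
      (by positivity : 0 ≤ Real.exp (-ε) / (1 + Real.exp (-ε)))
      (by positivity : 0 ≤ 1 / (1 + Real.exp (-ε))) (by field_simp; ring)
    simp only [smul_eq_mul] at this
    rw [show Real.exp (-ε) / (1 + Real.exp (-ε)) * (x * Real.exp (a + b)) +
      1 / (1 + Real.exp (-ε)) * (x * Real.exp (a + b - ε - ε)) = x * Real.exp (a + b - ε) by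
        rw [sub_eq_add_neg _ ε, sub_eq_add_neg _ ε, Real.exp_add _ (-ε), Real.exp_add _ (-ε)]
        field_simp] at this
    calc _ ≤ (1 + Real.exp (-ε)) * (Real.exp (-ε) / (1 + Real.exp (-ε)) *
          φ (x * Real.exp (a + b)) + 1 / (1 + Real.exp (-ε)) *
          φ (x * Real.exp (a + b - ε - ε))) :=
          mul_le_mul_of_nonneg_left this (by positivity)
      _ = _ := by field_simp
  have hσ : Real.exp (-m) + Real.exp (-(a + b - m)) ≤ Real.exp (-a) + Real.exp (-b) := by
    have e1 : Real.exp (-m) ≤ Real.exp (-a) := Real.exp_le_exp.2 (by linarith)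
    have e2 : Real.exp (-b) ≤ Real.exp (-m) := Real.exp_le_exp.2 (by linarith)
    have e3 : Real.exp (-(a + b - m)) * Real.exp (-m) = Real.exp (-a) * Real.exp (-b) := by
      rw [← Real.exp_add, ← Real.exp_add]
      ring_nf
    -- After multiplication by `e^(-m)`, the gap equals `(e^(-a) - e^(-m)) (e^(-m) - e^(-b))`.
    nlinarith [Real.exp_pos (-m), mul_nonneg (sub_nonneg.2 e1) (sub_nonneg.2 e2)]
  have hπ : Real.exp (-m) * Real.exp (-(a + b - m)) = Real.exp (-a) * Real.exp (-b) := by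
    rw [← Real.exp_add, ← Real.exp_add]
    ring_nf
  rw [one_sub_grrP_of_pos hε a, one_sub_grrP_of_pos hε b, one_sub_grrP_of_pos hε m,
    one_sub_grrP_of_pos hε (a + b - m)]
  simp only [grrP_of_pos hε]
  generalize φ (x * Real.exp (a + b)) = A at *
  generalize φ (x * Real.exp (a + b - ε)) = B at *
  generalize φ (x * Real.exp (a + b - ε - ε)) = C at *
  generalize Real.exp (-ε) = α at *
  generalize Real.exp (-a) = p at *
  generalize Real.exp (-b) = q at *
  generalize Real.exp (-m) = r at *
  generalize Real.exp (-(a + b - m)) = w at *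
  rw [← sub_nonneg]
  -- The gain factors into the drop of the sum of exponentials and the convexity defect `conv`.
  have : (r - α) / (1 - α) * ((w - α) / (1 - α)) * A + ((r - α) / (1 - α) * ((1 - w) / (1 - α)) +
      (1 - r) / (1 - α) * ((w - α) / (1 - α))) * B + (1 - r) / (1 - α) * ((1 - w) / (1 - α)) * C -
      ((p - α) / (1 - α) * ((q - α) / (1 - α)) * A + ((p - α) / (1 - α) * ((1 - q) / (1 - α)) +
      (1 - p) / (1 - α) * ((q - α) / (1 - α))) * B + (1 - p) / (1 - α) * ((1 - q) / (1 - α)) * C)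
      = ((p + q) - (r + w)) * (α * A + C - (1 + α) * B) / (1 - α) ^ 2 := by
    field_simp
    linear_combination (A - 2 * B + C) * hπ
  rw [this]
  exact div_nonneg (mul_nonneg (by linarith) (by linarith)) (by positivity)

theorem Multiset.exists_lt_and_exists_gt_of_sum_eq {s : Multiset ℝ} {m : ℝ}
    (hs : s.sum = s.card * m) (h : ∃ t ∈ s, t ≠ m) : (∃ a ∈ s, a < m) ∧ ∃ b ∈ s, m < b := by
  obtain ⟨t, ht, htm⟩ := h
  constructor
  · by_contra! hcon
    refine absurd (Multiset.sum_lt_sum (s := s) (f := fun _ => m) (g := id) hcon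
      ⟨t, ht, lt_of_le_of_ne (hcon t ht) htm.symm⟩) ?_
    simp [hs]
  · by_contra! hcon
    refine absurd (Multiset.sum_lt_sum (s := s) (f := id) (g := fun _ => m) hcon
      ⟨t, ht, lt_of_le_of_ne (hcon t ht) htm⟩) ?_
    simp [hs]

/-- Smoothing: unless all parameters equal the mean `m`, one lies below and one above it. Replacing
them by `m` and `a + b - m` leaves, beside the finished `m`, one parameter fewer with the same mean.
-/
theorem foldr_grrStep_le_iterate {ε : ℝ} {φ : ℝ → ℝ} (hφ : ConvexOn ℝ (Set.Ici 0) φ) (k : ℕ)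
    (s : Multiset ℝ) (hk : s.card = k) (hs : ∀ t ∈ s, t ∈ Set.Icc 0 ε) (m : ℝ)
    (hm : m ∈ Set.Icc 0 ε) (hsum : s.sum = k * m) {x : ℝ} (hx : 0 ≤ x) :
    s.foldr (grrStep ε) φ x ≤ (grrStep ε m)^[k] φ x := by
  induction k generalizing s x with
  | zero => simp [Multiset.card_eq_zero.1 hk]
  | succ n ih =>
    by_cases hall : ∃ t ∈ s, t ≠ m
    · obtain ⟨⟨a, ha, ham⟩, b, hb, hmb⟩ :=
        Multiset.exists_lt_and_exists_gt_of_sum_eq (by rw [hsum, hk]) hall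
      obtain ⟨s', rfl⟩ := Multiset.exists_cons_of_mem ha
      obtain ⟨s', rfl⟩ := Multiset.exists_cons_of_mem
        ((Multiset.mem_cons.1 hb).resolve_left (ham.trans hmb).ne')
      have hs' : ∀ t ∈ s', t ∈ Set.Icc 0 ε := fun t ht => hs t (by simp [ht])
      have ha' := hs a (by simp)
      have hb' := hs b (by simp)
      have hmem : ∀ t ∈ (a + b - m) ::ₘ s', t ∈ Set.Icc 0 ε := by
        intro t ht
        rcases Multiset.mem_cons.1 ht with rfl | ht
        · exact ⟨by linarith [ha'.1], by linarith [hb'.2]⟩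
        · exact hs' t ht
      have step := grrStep_grrStep_le (ha'.1.trans_lt (ham.trans_le hm.2)) ham.le hmb.le
        (convexOn_foldr_grrStep hφ s' hs') hx
      rw [Multiset.foldr_cons, Multiset.foldr_cons, Function.iterate_succ_apply']
      refine step.trans (grrStep_mono hm (fun y hy => ?_) hx)
      have key := ih ((a + b - m) ::ₘ s') (by simpa using hk) hmem (by
        simp only [Multiset.sum_cons] at hsum ⊢
        push_cast at hsum
        linarith) hy
      rwa [Multiset.foldr_cons] at key
    · push Not at hall
      rw [Multiset.eq_replicate.2 ⟨hk, hall⟩]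
      clear hk hs hsum hall
      suffices h : ∀ n, (Multiset.replicate n m).foldr (grrStep ε) φ = (grrStep ε m)^[n] φ by
        rw [h]
      intro n
      induction n with
      | zero => simp
      | succ n ih => rw [Multiset.replicate_succ, Multiset.foldr_cons, ih,
          Function.iterate_succ_apply']

theorem exists_foldr_grrStep_le_binomialDelta {ε : ℝ} (hε : 0 ≤ ε) (k : ℕ) (εg : ℝ)
    (s : Multiset ℝ) (hk : s.card = k) (hs : ∀ t ∈ s, t ∈ Set.Icc 0 ε) :
    ∃ t ∈ Set.Icc 0 ε,
      s.foldr (grrStep ε) (fun x => max (x - Real.exp εg) 0) 1 ≤ binomialDelta k ε εg t := by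
  simp only [binomialDelta_eq_iterate]
  rcases k.eq_zero_or_pos with rfl | hpos
  · exact ⟨0, ⟨le_rfl, hε⟩, by simp [Multiset.card_eq_zero.1 hk]⟩
  have hpos' : (0 : ℝ) < k := by exact_mod_cast hpos
  have hmem : s.sum / k ∈ Set.Icc 0 ε := by
    constructor
    · exact div_nonneg (Multiset.sum_nonneg fun t ht => (hs t ht).1) hpos'.le
    · rw [div_le_iff₀ hpos', mul_comm]
      simpa [hk] using Multiset.sum_le_card_nsmul s ε fun t ht => (hs t ht).2
  exact ⟨_, hmem, foldr_grrStep_le_iterate (convexOn_max_sub _) k s hk hs _ hmem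
    (by field_simp) zero_le_one⟩

/-! ## Maximizing over the common parameter -/

open Polynomial in
-- The derivatives of consecutive Bernstein polynomials telescope.
theorem derivative_sum_bernsteinPolynomial (k ℓ : ℕ) :
    derivative (∑ i ∈ Finset.range (ℓ + 1), bernsteinPolynomial ℝ k i) =
      -(k : ℝ[X]) * bernsteinPolynomial ℝ (k - 1) ℓ := by
  induction ℓ with
  | zero => simp [bernsteinPolynomial.derivative_zero]
  | succ n ih =>
    rw [Finset.sum_range_succ, derivative_add, ih, bernsteinPolynomial.derivative_succ]
    ring

theorem bernsteinPolynomial_eval (k i : ℕ) (x : ℝ) :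
    (bernsteinPolynomial ℝ k i).eval x = k.choose i * x ^ i * (1 - x) ^ (k - i) := by
  simp [bernsteinPolynomial]

/-- The signed sum of the first `ℓ + 1` summands of `binomialDelta`. -/
noncomputable def thresholdDelta (k : ℕ) (ε εg : ℝ) (ℓ : ℕ) (t : ℝ) : ℝ :=
  ∑ i ∈ Finset.range (ℓ + 1), (k.choose i : ℝ) * grrP ε t ^ (k - i) * (1 - grrP ε t) ^ i *
    (Real.exp (k * t - i * ε) - Real.exp εg)

theorem thresholdDelta_le_binomialDelta {k ℓ : ℕ} (hℓ : ℓ ≤ k) {ε t : ℝ} (εg : ℝ)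
    (ht : t ∈ Set.Icc 0 ε) : thresholdDelta k ε εg ℓ t ≤ binomialDelta k ε εg t := by
  have hp := grrP_nonneg ht
  have hq := one_sub_grrP_nonneg ht
  refine (Finset.sum_le_sum fun i _ => ?_).trans
    (Finset.sum_le_sum_of_subset_of_nonneg (Finset.range_mono (Nat.succ_le_succ hℓ))
      fun i _ _ => ?_)
  · exact mul_le_mul_of_nonneg_left (le_max_left _ _) (by positivity)
  · exact mul_nonneg (by positivity) (le_max_right _ _)

theorem binomialDelta_nonneg (k : ℕ) {ε t : ℝ} (εg : ℝ) (ht : t ∈ Set.Icc 0 ε) :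
    0 ≤ binomialDelta k ε εg t := by
  have hp := grrP_nonneg ht
  have hq := one_sub_grrP_nonneg ht
  exact Finset.sum_nonneg fun i _ => mul_nonneg (by positivity) (le_max_right _ _)

/-- As `ε ≥ 0`, the exponent `k t - i ε` does not increase with `i`, so the nonnegative differences
form an initial segment. The value zero covers the empty segment. -/
theorem binomialDelta_eq_zero_or_eq_thresholdDelta (k : ℕ) {ε : ℝ} (hε : 0 ≤ ε) (εg t : ℝ) :
    binomialDelta k ε εg t = 0 ∨ ∃ ℓ ≤ k, binomialDelta k ε εg t = thresholdDelta k ε εg ℓ t := by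
  suffices h : ∀ n, (∑ i ∈ Finset.range n, (k.choose i : ℝ) * grrP ε t ^ (k - i) *
      (1 - grrP ε t) ^ i * max (Real.exp (k * t - i * ε) - Real.exp εg) 0) = 0 ∨
      ∃ ℓ < n, (∑ i ∈ Finset.range n, (k.choose i : ℝ) * grrP ε t ^ (k - i) *
        (1 - grrP ε t) ^ i * max (Real.exp (k * t - i * ε) - Real.exp εg) 0) =
          thresholdDelta k ε εg ℓ t by
    simpa [Nat.lt_succ_iff, binomialDelta] using h (k + 1)
  intro n
  induction n with
  | zero => simp
  | succ n ih =>
    by_cases hn : 0 ≤ Real.exp (k * t - n * ε) - Real.exp εg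
    · refine Or.inr ⟨n, n.lt_succ_self, Finset.sum_congr rfl fun i hi => ?_⟩
      rw [max_eq_left]
      have hi' : (i : ℝ) ≤ n := by exact_mod_cast Nat.lt_succ_iff.1 (Finset.mem_range.1 hi)
      have : Real.exp (k * t - n * ε) ≤ Real.exp (k * t - i * ε) :=
        Real.exp_le_exp.2 (by nlinarith)
      linarith
    · rw [Finset.sum_range_succ, max_eq_right (not_le.1 hn).le, mul_zero, add_zero]
      exact ih.imp_right fun ⟨ℓ, hℓ, h⟩ => ⟨ℓ, hℓ.trans n.lt_succ_self, h⟩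

theorem tStar_mem (k : ℕ) {ε : ℝ} (hε : 0 ≤ ε) (εg : ℝ) (ℓ : ℕ) :
    tStar k ε εg ℓ ∈ Set.Icc 0 ε :=
  ⟨le_max_left _ _, max_le hε (min_le_left _ _)⟩

/-- The partial sum is `B(a) - e^εg B(b)`, where `B(x)` is the probability of at most `ℓ` successes
in `k` trials and `a`, `b` are the probabilities of the answer `1` under the two inputs. Both
derivatives reduce to one Bernstein term. -/
theorem hasDerivAt_thresholdDelta {k ℓ : ℕ} (hℓ : ℓ ≤ k) {ε : ℝ} (hε : 0 < ε) (εg t : ℝ) :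
    HasDerivAt (thresholdDelta k ε εg ℓ)
      (k * (Real.exp (-t) / (1 - Real.exp (-ε))) *
        (((k - 1).choose ℓ : ℝ) * (1 - grrP ε t) ^ ℓ * grrP ε t ^ (k - 1 - ℓ)) *
        (Real.exp εg - Real.exp ((k + 1) * t - (ℓ + 1) * ε))) t := by
  have h1 := one_sub_exp_neg_pos hε
  have h0 := Real.exp_pos (-ε)
  set B := ∑ i ∈ Finset.range (ℓ + 1), bernsteinPolynomial ℝ k i with hB
  set b : ℝ → ℝ := fun t => (1 - Real.exp (-t)) / (1 - Real.exp (-ε)) with hb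
  set a : ℝ → ℝ := fun t => Real.exp (-ε) * (Real.exp t - 1) / (1 - Real.exp (-ε)) with ha
  have hab : ∀ t, a t = Real.exp (t - ε) * b t := by
    intro t
    have : Real.exp t * Real.exp (-t) = 1 := by rw [← Real.exp_add]; simp
    simp only [ha, hb, sub_eq_add_neg t ε, Real.exp_add]
    field_simp
    linear_combination this
  have hab' : ∀ t, 1 - a t = Real.exp t * (1 - b t) := by
    intro t
    have : Real.exp t * Real.exp (-t) = 1 := by rw [← Real.exp_add]; simp
    simp only [ha, hb]
    field_simp
    linear_combination -this
  have hp : ∀ t, grrP ε t = 1 - b t := fun t => by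
    rw [← sub_sub_cancel 1 (grrP ε t), one_sub_grrP_of_pos hε]
  have heq : thresholdDelta k ε εg ℓ = fun t => B.eval (a t) - Real.exp εg * B.eval (b t) := by
    funext t
    simp only [hB, Polynomial.eval_finsetSum, bernsteinPolynomial_eval, Finset.mul_sum,
      thresholdDelta, hp, ← Finset.sum_sub_distrib]
    refine Finset.sum_congr rfl fun i hi => ?_
    have hik : i ≤ k := (Nat.lt_succ_iff.1 (Finset.mem_range.1 hi)).trans hℓ
    rw [hab', hab, mul_pow, mul_pow, ← Real.exp_nat_mul, ← Real.exp_nat_mul]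
    have : Real.exp (k * t - i * ε) = Real.exp (i * (t - ε)) * Real.exp ((k - i : ℕ) * t) := by
      rw [← Real.exp_add, Nat.cast_sub hik]
      ring_nf
    rw [this]
    ring
  have hda : HasDerivAt a (Real.exp (-ε) * Real.exp t / (1 - Real.exp (-ε))) t :=
    (((Real.hasDerivAt_exp t).sub_const 1).const_mul _).div_const _
  have hdb : HasDerivAt b (Real.exp (-t) / (1 - Real.exp (-ε))) t := by
    have := (((hasDerivAt_neg t).exp).const_sub 1).div_const (1 - Real.exp (-ε))
    simpa using this
  have hd := ((B.hasDerivAt (a t)).comp t hda).sub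
    (((B.hasDerivAt (b t)).comp t hdb).const_mul (Real.exp εg))
  rw [heq]
  refine hd.congr_deriv ?_
  rw [hB, derivative_sum_bernsteinPolynomial]
  simp only [Polynomial.eval_mul, Polynomial.eval_neg, Polynomial.eval_natCast,
    bernsteinPolynomial_eval]
  rcases hℓ.lt_or_eq with hlt | rfl
  · rw [hab', hab, hp, mul_pow, mul_pow, ← Real.exp_nat_mul, ← Real.exp_nat_mul]
    have hexp : Real.exp (ℓ * (t - ε)) * Real.exp ((k - 1 - ℓ : ℕ) * t) *
        (Real.exp (-ε) * Real.exp t) =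
        Real.exp (-t) * Real.exp ((k + 1) * t - (ℓ + 1) * ε) := by
      rw [← Real.exp_add, ← Real.exp_add, ← Real.exp_add, ← Real.exp_add, Nat.sub_sub,
        Nat.cast_sub (by omega)]
      push_cast
      ring_nf
    generalize Real.exp (ℓ * (t - ε)) = x₁ at hexp ⊢
    generalize Real.exp ((k - 1 - ℓ : ℕ) * t) = x₂ at hexp ⊢
    generalize Real.exp ((k + 1) * t - (ℓ + 1) * ε) = x₃ at hexp ⊢
    generalize b t = y
    field_simp
    linear_combination (-(k : ℝ) * ((k - 1).choose ℓ : ℝ) * y ^ ℓ *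
      (1 - y) ^ (k - 1 - ℓ)) * hexp
  -- For `ℓ = k` both sides vanish: through the binomial coefficient if `k > 0`, through the factor
  -- `k` if `k = 0`, where truncated subtraction leaves the coefficient equal to 1.
  · rcases ℓ.eq_zero_or_pos with rfl | hpos
    · simp
    · simp [Nat.choose_eq_zero_of_lt (Nat.sub_lt hpos one_pos)]

theorem thresholdDelta_le_tStar {k ℓ : ℕ} (hℓ : ℓ ≤ k) {ε : ℝ} (hε : 0 < ε) (εg : ℝ) {t : ℝ}
    (ht : t ∈ Set.Icc 0 ε) :
    thresholdDelta k ε εg ℓ t ≤ thresholdDelta k ε εg ℓ (tStar k ε εg ℓ) := by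
  have hts := tStar_mem k hε.le εg ℓ
  have hd := fun s => hasDerivAt_thresholdDelta hℓ hε εg s
  have hcont : Continuous (thresholdDelta k ε εg ℓ) :=
    continuous_iff_continuousAt.2 fun s => (hd s).continuousAt
  have hk : (0 : ℝ) < k + 1 := by positivity
  have hfac : ∀ s ∈ Set.Icc 0 ε, 0 ≤ k * (Real.exp (-s) / (1 - Real.exp (-ε))) *
      (((k - 1).choose ℓ : ℝ) * (1 - grrP ε s) ^ ℓ * grrP ε s ^ (k - 1 - ℓ)) := by
    intro s hs
    have hp := grrP_nonneg hs
    have hq := one_sub_grrP_nonneg hs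
    have := one_sub_exp_neg_pos hε
    positivity
  rcases le_total t (tStar k ε εg ℓ) with hle | hle
  · refine monotoneOn_of_deriv_nonneg (convex_Icc t (tStar k ε εg ℓ)) hcont.continuousOn
      (fun s _ => (hd s).differentiableAt.differentiableWithinAt) (fun s hs => ?_)
      (Set.left_mem_Icc.2 hle) (Set.right_mem_Icc.2 hle) hle
    rw [interior_Icc] at hs
    rw [(hd s).deriv]
    refine mul_nonneg (hfac s ⟨ht.1.trans hs.1.le, hs.2.le.trans hts.2⟩)
      (sub_nonneg.2 (Real.exp_le_exp.2 ?_))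
    -- As `0 ≤ s < tStar`, clipping at `0` is not active, so `s` is below the unclipped point too.
    have h1 : s < (εg + (ℓ + 1) * ε) / (k + 1) :=
      ((lt_max_iff.1 hs.2).resolve_left (not_lt.2 (ht.1.trans hs.1.le))).trans_le
        (min_le_right _ _)
    rw [lt_div_iff₀ hk] at h1
    linarith
  · refine antitoneOn_of_deriv_nonpos (convex_Icc (tStar k ε εg ℓ) t) hcont.continuousOn
      (fun s _ => (hd s).differentiableAt.differentiableWithinAt) (fun s hs => ?_)
      (Set.left_mem_Icc.2 hle) (Set.right_mem_Icc.2 hle) hle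
    rw [interior_Icc] at hs
    rw [(hd s).deriv]
    refine mul_nonpos_of_nonneg_of_nonpos (hfac s ⟨hts.1.trans hs.1.le, hs.2.le.trans ht.2⟩)
      (sub_nonpos.2 (Real.exp_le_exp.2 ?_))
    have h1 : (εg + (ℓ + 1) * ε) / (k + 1) < s :=
      (min_lt_iff.1 ((max_lt_iff.1 hs.1).2)).resolve_left (not_lt.2 (hs.2.le.trans ht.2))
    rw [div_lt_iff₀ hk] at h1
    linarith

theorem exists_binomialDelta_le_tStar (k : ℕ) {ε : ℝ} (hε : 0 ≤ ε) (εg : ℝ) {t : ℝ}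
    (ht : t ∈ Set.Icc 0 ε) :
    ∃ ℓ ≤ k, binomialDelta k ε εg t ≤ binomialDelta k ε εg (tStar k ε εg ℓ) := by
  rcases hε.eq_or_lt with rfl | hpos
  · have h0 : t = tStar k 0 εg 0 := by
      have := tStar_mem k le_rfl εg 0
      linarith [ht.1, ht.2, this.1, this.2]
    exact ⟨0, k.zero_le, by rw [← h0]⟩
  · rcases binomialDelta_eq_zero_or_eq_thresholdDelta k hε εg t with h | ⟨ℓ, hℓ, h⟩
    · exact ⟨0, k.zero_le, h ▸ binomialDelta_nonneg k εg (tStar_mem k hε εg 0)⟩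
    · exact ⟨ℓ, hℓ, h ▸ (thresholdDelta_le_tStar hℓ hpos εg ht).trans
        (thresholdDelta_le_binomialDelta hℓ εg (tStar_mem k hε εg ℓ))⟩

/-! ## The privacy loss of a product of bounded-range mechanisms -/

section BoundedRange

variable {Ω Ω' : Type*} [MeasurableSpace Ω] [MeasurableSpace Ω']

/-- Let `m` be the supremum of the ratio where `f' ≠ 0`. There the ratio lies in `[e^(-ε) m, m]`,
and its `Q`-mean is 1, so `1 ≤ m ≤ e^ε` and `t = log m` works. -/
theorem exists_boundedRange_ratio {P Q : Measure Ω} [IsProbabilityMeasure P]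
    [IsProbabilityMeasure Q] {ε : ℝ} {μ : Measure Ω} {f f' : Ω → ℝ≥0} (hf : Measurable f)
    (hf' : Measurable f') (hP : P = μ.withDensity fun y => (f y : ℝ≥0∞))
    (hQ : Q = μ.withDensity fun y => (f' y : ℝ≥0∞))
    (h : ∀ y₁ y₂ : Ω, (f y₁ : ℝ) * f' y₂ ≤ Real.exp ε * (f y₂ * f' y₁)) :
    ∃ t ∈ Set.Icc 0 ε, ∃ L : Ω → ℝ≥0, Measurable L ∧
      (∀ y, Real.exp (t - ε) ≤ L y ∧ (L y : ℝ) ≤ Real.exp t) ∧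
      P = Q.withDensity fun y => (L y : ℝ≥0∞) := by
  have hne : ∃ y, f' y ≠ 0 := by
    by_contra! hcon
    have : Q = 0 := by rw [hQ]; simp [hcon]
    exact IsProbabilityMeasure.ne_zero Q this
  obtain ⟨y₀, hy₀⟩ := hne
  have hy₀' : (0 : ℝ) < f' y₀ := by exact_mod_cast pos_iff_ne_zero.2 hy₀
  have hz : ∀ y, f' y = 0 → f y = 0 := by
    intro y hy
    have := h y y₀
    rw [hy, NNReal.coe_zero, mul_zero, mul_zero] at this
    have : (f y : ℝ) ≤ 0 := nonpos_of_mul_nonpos_left this hy₀'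
    exact_mod_cast le_antisymm this (f y).2
  set R : Ω → ℝ≥0 := fun y => f y / f' y with hR
  have hRm : Measurable R := hf.div hf'
  have hPQ : P = Q.withDensity fun y => (R y : ℝ≥0∞) := by
    rw [hQ, ← withDensity_mul _ hf'.coe_nnreal_ennreal hRm.coe_nnreal_ennreal, hP]
    congr 1
    funext y
    simp only [Pi.mul_apply, hR, ← ENNReal.coe_mul]
    by_cases hy : f' y = 0
    · simp [hy, hz y hy]
    · rw [mul_div_cancel₀ _ hy]
  have hRR : ∀ y₁ y₂, f' y₁ ≠ 0 → f' y₂ ≠ 0 → (R y₁ : ℝ) ≤ Real.exp ε * R y₂ := by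
    intro y₁ y₂ h1 h2
    have h1' : (0 : ℝ) < f' y₁ := by exact_mod_cast pos_iff_ne_zero.2 h1
    have h2' : (0 : ℝ) < f' y₂ := by exact_mod_cast pos_iff_ne_zero.2 h2
    simp only [hR, NNReal.coe_div]
    rw [mul_div_assoc', div_le_div_iff₀ h1' h2']
    linarith [h y₁ y₂]
  set T : Set ℝ := (fun y => (R y : ℝ)) '' {y | f' y ≠ 0} with hT
  have hTne : T.Nonempty := ⟨_, y₀, hy₀, rfl⟩
  have hTb : BddAbove T := ⟨Real.exp ε * R y₀, by
    rintro _ ⟨y, hy, rfl⟩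
    exact hRR y y₀ hy hy₀⟩
  set m := sSup T with hm
  have hle : ∀ y, f' y ≠ 0 → (R y : ℝ) ≤ m := fun y hy => le_csSup hTb ⟨y, hy, rfl⟩
  have hge : ∀ y, f' y ≠ 0 → m ≤ Real.exp ε * R y := fun y hy =>
    csSup_le hTne (by rintro _ ⟨y', hy', rfl⟩; exact hRR y' y hy' hy)
  have hae : ∀ᵐ y ∂Q, f' y ≠ 0 := by
    rw [hQ, ae_withDensity_iff hf'.coe_nnreal_ennreal]
    exact Filter.Eventually.of_forall fun y hy => by exact_mod_cast hy
  have hint : ∫⁻ y, (R y : ℝ≥0∞) ∂Q = 1 := by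
    have := congrArg (fun ν : Measure Ω => ν Set.univ) hPQ
    simpa using this.symm
  have hm0 : 0 ≤ m := (R y₀).2.trans (hle y₀ hy₀)
  have hm1 : 1 ≤ m := by
    have : ∫⁻ y, (R y : ℝ≥0∞) ∂Q ≤ ∫⁻ _, ENNReal.ofReal m ∂Q := by
      refine lintegral_mono_ae (hae.mono fun y hy => ?_)
      rw [← ENNReal.ofReal_coe_nnreal]
      exact ENNReal.ofReal_le_ofReal (hle y hy)
    rw [hint] at this
    simpa using this
  have hm2 : m ≤ Real.exp ε := by
    have : ∫⁻ _, ENNReal.ofReal (m / Real.exp ε) ∂Q ≤ ∫⁻ y, (R y : ℝ≥0∞) ∂Q := by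
      refine lintegral_mono_ae (hae.mono fun y hy => ?_)
      rw [← ENNReal.ofReal_coe_nnreal]
      refine ENNReal.ofReal_le_ofReal ?_
      rw [div_le_iff₀ (Real.exp_pos ε), mul_comm]
      exact hge y hy
    rw [hint] at this
    have : m / Real.exp ε ≤ 1 := by simpa using this
    rwa [div_le_one (Real.exp_pos ε)] at this
  have hmpos : 0 < m := by linarith
  -- On the `Q`-null set `f' = 0` the ratio is reset to 1, which lies in the window, so that the
  -- bounds hold everywhere.
  refine ⟨Real.log m, ⟨Real.log_nonneg hm1, (Real.log_le_iff_le_exp hmpos).2 hm2⟩,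
    fun y => if f' y = 0 then 1 else R y,
    Measurable.ite (hf' (measurableSet_singleton 0)) measurable_const hRm, fun y => ?_, ?_⟩
  · rw [Real.exp_sub, Real.exp_log hmpos, div_le_iff₀ (Real.exp_pos ε), mul_comm]
    by_cases hy : f' y = 0
    · simpa [hy] using ⟨hm2, hm1⟩
    · simpa [hy] using ⟨hge y hy, hle y hy⟩
  · rw [hPQ]
    refine withDensity_congr_ae (hae.mono fun y hy => ?_)
    simp [hy]

/-- The affine function is the chord over the window. Its value at `r = 1` is `grrStep ε t φ a`,
because `grrP` is the weight that gives the two endpoints mean 1. -/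
theorem ConvexOn.exists_affine_bound {φ : ℝ → ℝ} (hφ : ConvexOn ℝ (Set.Ici 0) φ) {ε t : ℝ}
    (ht : t ∈ Set.Icc 0 ε) {a : ℝ} (ha : 0 ≤ a) :
    ∃ α β : ℝ, α + β = grrStep ε t φ a ∧
      ∀ r ∈ Set.Icc (Real.exp (t - ε)) (Real.exp t), φ (a * r) ≤ α + β * r := by
  rcases (ht.1.trans ht.2).eq_or_lt with rfl | hε
  · obtain rfl : t = 0 := le_antisymm ht.2 ht.1
    refine ⟨φ a, 0, by simp [grrStep, grrP], fun r hr => ?_⟩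
    obtain rfl : r = 1 := by simpa using hr
    simp
  have hlt : Real.exp (t - ε) < Real.exp t := Real.exp_lt_exp.2 (by linarith)
  have h1 := one_sub_exp_neg_pos hε
  set u := Real.exp t with hu
  set w := Real.exp (t - ε) with hw
  have hw0 : 0 < w := Real.exp_pos _
  have hwu : w = u * Real.exp (-ε) := by rw [hw, hu, ← Real.exp_add]; ring_nf
  have hut : u * Real.exp (-t) = 1 := by rw [hu, ← Real.exp_add]; simp
  have hd : 0 < u - w := by linarith
  have hp : grrP ε t = (1 - w) / (u - w) := by
    rw [grrP_of_pos hε, div_eq_div_iff h1.ne' hd.ne', hwu]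
    linear_combination (1 - Real.exp (-ε)) * hut
  refine ⟨(u * φ (a * w) - w * φ (a * u)) / (u - w), (φ (a * u) - φ (a * w)) / (u - w), ?_,
    fun r hr => ?_⟩
  · simp only [grrStep, hp, ← hu, ← hw]
    field_simp
    ring
  · have := hφ.2 (mul_nonneg ha (hw0.trans hlt).le : 0 ≤ a * u)
      (mul_nonneg ha hw0.le : 0 ≤ a * w) (div_nonneg (sub_nonneg.2 hr.1) hd.le)
      (div_nonneg (sub_nonneg.2 hr.2) hd.le) (by field_simp; ring)
    simp only [smul_eq_mul] at this
    rw [show (r - w) / (u - w) * (a * u) + (u - r) / (u - w) * (a * w) = a * r by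
      field_simp; ring] at this
    refine this.trans_eq ?_
    field_simp
    ring

theorem measureReal_prod_eq_integral (P : Measure Ω) [IsProbabilityMeasure P] (P' : Measure Ω')
    [IsProbabilityMeasure P'] {S : Set (Ω × Ω')} (hS : MeasurableSet S) :
    (P.prod P').real S = ∫ y, P'.real (Prod.mk y ⁻¹' S) ∂P := by
  rw [measureReal_def, Measure.prod_apply hS, ← integral_toReal
    (measurable_measure_prodMk_left hS).aemeasurable
    (Filter.Eventually.of_forall fun y => measure_lt_top _ _)]
  rfl

/-- On the slice at `y` the hypothesis applies with coefficient `a * L y`; this is why it is needed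
for all `a ≥ 0`. The chord bound then integrates exactly, as `L` has `Q`-mean 1. -/
theorem prod_sub_le_grrStep {P Q : Measure Ω} [IsProbabilityMeasure P]
    [IsProbabilityMeasure Q] {P' Q' : Measure Ω'} [IsProbabilityMeasure P']
    [IsProbabilityMeasure Q'] {ε t : ℝ} (ht : t ∈ Set.Icc 0 ε) {L : Ω → ℝ≥0} (hL : Measurable L)
    (hLb : ∀ y, Real.exp (t - ε) ≤ L y ∧ (L y : ℝ) ≤ Real.exp t)
    (hPQ : P = Q.withDensity fun y => (L y : ℝ≥0∞)) {φ : ℝ → ℝ}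
    (hφ : ConvexOn ℝ (Set.Ici 0) φ) {c : ℝ}
    (h : ∀ a, 0 ≤ a → ∀ S, MeasurableSet S → a * P'.real S - c * Q'.real S ≤ φ a)
    {a : ℝ} (ha : 0 ≤ a) {S : Set (Ω × Ω')} (hS : MeasurableSet S) :
    a * (P.prod P').real S - c * (Q.prod Q').real S ≤ grrStep ε t φ a := by
  obtain ⟨α, β, hαβ, hb⟩ := hφ.exists_affine_bound ht ha
  have hLint : Integrable (fun y => (L y : ℝ)) Q :=
    Integrable.of_bound hL.coe_nnreal_real.aestronglyMeasurable (Real.exp t)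
      (Filter.Eventually.of_forall fun y => by
        rw [Real.norm_of_nonneg (NNReal.coe_nonneg _)]; exact (hLb y).2)
  have hL1 : ∫ y, (L y : ℝ) ∂Q = 1 := by
    have := integral_withDensity_eq_integral_smul (μ := Q) hL (fun _ => (1 : ℝ))
    rw [← hPQ] at this
    simpa [NNReal.smul_def] using this.symm
  have hP'S : Measurable fun y => P'.real (Prod.mk y ⁻¹' S) :=
    (measurable_measure_prodMk_left hS).ennreal_toReal
  have i1 : Integrable (fun y => (L y : ℝ) * P'.real (Prod.mk y ⁻¹' S)) Q :=
    hLint.mul_bdd (c := 1) hP'S.aestronglyMeasurable (Filter.Eventually.of_forall fun y => by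
      rw [Real.norm_of_nonneg measureReal_nonneg]; exact measureReal_le_one)
  have i2 : Integrable (fun y => Q'.real (Prod.mk y ⁻¹' S)) Q :=
    Measure.integrable_measure_prodMk_left hS (measure_ne_top _ _)
  have e1 : (P.prod P').real S = ∫ y, (L y : ℝ) * P'.real (Prod.mk y ⁻¹' S) ∂Q := by
    rw [measureReal_prod_eq_integral P P' hS, hPQ, integral_withDensity_eq_integral_smul hL]
    simp [NNReal.smul_def]
  rw [e1, measureReal_prod_eq_integral Q Q' hS, ← integral_const_mul, ← integral_const_mul,
    ← integral_sub (i1.const_mul a) (i2.const_mul c), ← hαβ]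
  calc _ ≤ ∫ y, α + β * (L y : ℝ) ∂Q := by
        refine integral_mono ((i1.const_mul a).sub (i2.const_mul c))
          ((integrable_const α).add (hLint.const_mul β)) fun y => ?_
        have hy := (h (a * L y) (mul_nonneg ha (NNReal.coe_nonneg _)) _
          (measurable_prodMk_left (x := y) hS)).trans (hb (L y) (hLb y))
        rw [mul_assoc] at hy
        exact hy
    _ = α + β := by
        rw [integral_add (integrable_const α) (hLint.const_mul β), integral_const_mul, hL1]
        simp

end BoundedRange

theorem exists_pi_sub_le_foldr_grrStep {ε : ℝ} {c : ℝ} (k : ℕ) {Ω : Fin k → Type u}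
    [∀ i, MeasurableSpace (Ω i)] (P Q : ∀ i, Measure (Ω i)) [∀ i, IsProbabilityMeasure (P i)]
    [∀ i, IsProbabilityMeasure (Q i)]
    (h : ∀ i, ∃ t ∈ Set.Icc 0 ε, ∃ L : Ω i → ℝ≥0, Measurable L ∧
      (∀ y, Real.exp (t - ε) ≤ L y ∧ (L y : ℝ) ≤ Real.exp t) ∧
      P i = (Q i).withDensity fun y => (L y : ℝ≥0∞)) :
    ∃ s : Multiset ℝ, s.card = k ∧ (∀ t ∈ s, t ∈ Set.Icc 0 ε) ∧
      ∀ a, 0 ≤ a → ∀ S, MeasurableSet S →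
        a * (Measure.pi P).real S - c * (Measure.pi Q).real S ≤
          s.foldr (grrStep ε) (fun x => max (x - c) 0) a := by
  induction k with
  | zero =>
    refine ⟨0, rfl, by simp, fun a ha S hS => ?_⟩
    have hPQ : Measure.pi P = Measure.pi Q := by
      rw [Measure.pi_of_empty P, Measure.pi_of_empty Q]
    rw [hPQ, ← sub_mul, Multiset.foldr_zero]
    have h0 : 0 ≤ (Measure.pi Q).real S := measureReal_nonneg
    have h1 : (Measure.pi Q).real S ≤ 1 := measureReal_le_one
    calc _ ≤ max (a - c) 0 * (Measure.pi Q).real S :=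
          mul_le_mul_of_nonneg_right (le_max_left _ _) h0
      _ ≤ _ := mul_le_of_le_one_right (le_max_right _ _) h1
  | succ n ih =>
    obtain ⟨s, hcard, hs, hbound⟩ := ih (fun i => P (Fin.succAbove 0 i))
      (fun i => Q (Fin.succAbove 0 i)) fun i => h _
    obtain ⟨t, ht, L, hL, hLb, hPQ⟩ := h 0
    refine ⟨t ::ₘ s, by simp [hcard], ?_, fun a ha S hS => ?_⟩
    · intro t' ht'
      rcases Multiset.mem_cons.1 ht' with rfl | h'
      · exact ht
      · exact hs _ h'
    · rw [Multiset.foldr_cons]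
      have hmp := (measurePreserving_piFinSuccAbove P 0).symm
      have hmq := (measurePreserving_piFinSuccAbove Q 0).symm
      rw [← hmp.measureReal_preimage hS.nullMeasurableSet,
        ← hmq.measureReal_preimage hS.nullMeasurableSet]
      exact prod_sub_le_grrStep ht hL hLb hPQ (convexOn_foldr_grrStep (convexOn_max_sub c) s hs)
        hbound ha (hmp.measurable hS)

namespace Mechanism

variable {X : Type v}

theorem deltaOpt_prod_le {nbr : X → X → Prop} (hnbr : ∃ x x', nbr x x') {k : ℕ} {ε : ℝ}
    (hε : 0 ≤ ε) (εg : ℝ) {N : Fin k → Mechanism.{u} X} (hN : ∀ i, (N i).IsBR nbr ε) :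
    (prod N).deltaOpt nbr εg ≤ (Finset.range (k + 1)).sup' Finset.nonempty_range_add_one
      fun ℓ => binomialDelta k ε εg (tStar k ε εg ℓ) := by
  refine (isGLB_deltaOpt hnbr _ εg).1 fun x x' hx S hS => ?_
  obtain ⟨s, hcard, hs, hbound⟩ := exists_pi_sub_le_foldr_grrStep (ε := ε) (c := Real.exp εg) k
    (fun i => (N i).law x) (fun i => (N i).law x') fun i => by
      obtain ⟨μ, f, f', -, hf, hf', hP, hQ, h⟩ := hN i x x' hx
      exact exists_boundedRange_ratio hf hf' hP hQ h
  have h1 := hbound 1 zero_le_one S hS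
  obtain ⟨t, ht, h2⟩ := exists_foldr_grrStep_le_binomialDelta hε k εg s hcard hs
  obtain ⟨ℓ, hℓ, h3⟩ := exists_binomialDelta_le_tStar k hε εg ht
  have h4 := Finset.le_sup' (fun ℓ => binomialDelta k ε εg (tStar k ε εg ℓ))
    (Finset.mem_range.2 (Nat.lt_succ_iff.2 hℓ))
  have h5 := h1.trans (h2.trans (h3.trans h4))
  rw [one_mul] at h5
  exact sub_le_iff_le_add'.1 h5

end Mechanism

/-! ## Generalized random response attains the bound -/

theorem sum_prod_mul_eq_iterate {B : Type*} [Fintype B] (q r : B → ℝ) (φ : ℝ → ℝ) (k : ℕ)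
    (x : ℝ) :
    ∑ y : Fin k → B, (∏ i, q (y i)) * φ (x * ∏ i, r (y i)) =
      (fun (ψ : ℝ → ℝ) x => ∑ b, q b * ψ (x * r b))^[k] φ x := by
  induction k generalizing x with
  | zero => simp
  | succ n ih =>
    rw [Function.iterate_succ_apply', ← (Fin.consEquiv fun _ : Fin (n + 1) => B).sum_comp,
      Fintype.sum_prod_type]
    refine Finset.sum_congr rfl fun b _ => ?_
    rw [← ih, Finset.mul_sum]
    refine Finset.sum_congr rfl fun y _ => ?_
    simp [Fin.prod_univ_succ, mul_assoc]

/-- Neyman–Pearson: the optimal event collects the outcomes of nonnegative signed mass. -/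
theorem exists_pi_sub_eq_sum_max {B : Type*} [Fintype B] [MeasurableSpace B]
    [MeasurableSingletonClass B] (P Q : Measure B) [IsProbabilityMeasure P]
    [IsProbabilityMeasure Q] (k : ℕ) (c : ℝ) :
    ∃ S, MeasurableSet S ∧
      (Measure.pi fun _ : Fin k => P).real S - c * (Measure.pi fun _ : Fin k => Q).real S =
        ∑ y : Fin k → B, max ((∏ i, P.real {y i}) - c * ∏ i, Q.real {y i}) 0 := by
  classical
  have hpi : ∀ (R : Measure B) [IsProbabilityMeasure R] (T : Finset (Fin k → B)),
      (Measure.pi fun _ : Fin k => R).real (T : Set (Fin k → B)) =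
        ∑ y ∈ T, ∏ i, R.real {y i} := by
    intro R _ T
    rw [← sum_measureReal_singleton]
    refine Finset.sum_congr rfl fun y _ => ?_
    rw [measureReal_def, Measure.pi_singleton, ENNReal.toReal_prod]
    rfl
  refine ⟨(Finset.univ.filter fun y : Fin k → B =>
    0 ≤ (∏ i, P.real {y i}) - c * ∏ i, Q.real {y i} : Finset (Fin k → B)),
    Finset.measurableSet _, ?_⟩
  rw [hpi P, hpi Q, Finset.mul_sum, ← Finset.sum_sub_distrib, Finset.sum_filter]
  refine Finset.sum_congr rfl fun y _ => ?_
  split_ifs with h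
  · exact (max_eq_left h).symm
  · exact (max_eq_right (not_le.1 h).le).symm

instance ULift.instMeasurableSingletonClass {α : Type*} [MeasurableSpace α]
    [MeasurableSingletonClass α] : MeasurableSingletonClass (ULift.{u} α) where
  measurableSet_singleton x := by
    rw [← measurableSet_preimage_up]
    convert measurableSet_singleton x.down
    ext y
    simp [ULift.ext_iff]

/-- The probability of the answer `y` of generalized random response on the input `0`. -/
noncomputable def grrMass (ε t : ℝ) (y : ULift.{u} Bool) : ℝ :=
  if y.down then 1 - grrP ε t else grrP ε t

/-- The ratio of the probabilities of the answer `y` of generalized random response on the inputs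
`1` and `0`. -/
noncomputable def grrRatio (ε t : ℝ) (y : ULift.{u} Bool) : ℝ :=
  if y.down then Real.exp (t - ε) else Real.exp t

theorem sum_ulift_bool (f : ULift.{u} Bool → ℝ) : ∑ y, f y = f ⟨false⟩ + f ⟨true⟩ := by
  rw [← Equiv.ulift.symm.sum_comp, Fintype.sum_bool, add_comm]
  rfl

theorem grrMass_nonneg {ε t : ℝ} (ht : t ∈ Set.Icc 0 ε) (y : ULift.{u} Bool) :
    0 ≤ grrMass ε t y := by
  unfold grrMass
  split_ifs
  · exact one_sub_grrP_nonneg ht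
  · exact grrP_nonneg ht

theorem grrRatio_pos (ε t : ℝ) (y : ULift.{u} Bool) : 0 < grrRatio ε t y := by
  unfold grrRatio
  split_ifs <;> positivity

theorem grrRatio_le (ε t : ℝ) (hε : 0 ≤ ε) (y y' : ULift.{u} Bool) :
    grrRatio ε t y ≤ Real.exp ε * grrRatio ε t y' := by
  unfold grrRatio
  split_ifs <;> rw [← Real.exp_add] <;> exact Real.exp_le_exp.2 (by linarith)

theorem sum_grrMass (ε t : ℝ) : ∑ y : ULift.{u} Bool, grrMass ε t y = 1 := by
  simp [sum_ulift_bool, grrMass]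

theorem grrStep_eq_sum (ε t : ℝ) (φ : ℝ → ℝ) (x : ℝ) :
    grrStep ε t φ x = ∑ y : ULift.{u} Bool, grrMass ε t y * φ (x * grrRatio ε t y) := by
  simp [sum_ulift_bool, grrMass, grrRatio, grrStep]

theorem sum_grrMass_mul_grrRatio {ε t : ℝ} (ht : t ∈ Set.Icc 0 ε) :
    ∑ y : ULift.{u} Bool, grrMass ε t y * grrRatio ε t y = 1 := by
  have := grrStep_eq_sum.{u} ε t id 1
  simp only [id, one_mul] at this
  rw [← this]
  rcases (ht.1.trans ht.2).eq_or_lt with rfl | hε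
  · obtain rfl : t = 0 := le_antisymm ht.2 ht.1
    simp [grrStep, grrP]
  · have h1 := one_sub_exp_neg_pos hε
    have hut : Real.exp t * Real.exp (-t) = 1 := by rw [← Real.exp_add]; simp
    simp only [grrStep, one_sub_grrP_of_pos hε, sub_eq_add_neg t ε, Real.exp_add, one_mul, id]
    rw [grrP_of_pos hε]
    field_simp
    linear_combination (1 - Real.exp (-ε)) * hut

/-- The measure on a finite type with prescribed masses. -/
noncomputable def massMeasure {B : Type*} [MeasurableSpace B] (f : B → ℝ) : Measure B :=
  Measure.count.withDensity fun y => ((f y).toNNReal : ℝ≥0∞)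

theorem massMeasure_real_singleton {B : Type*} [MeasurableSpace B] [MeasurableSingletonClass B]
    {f : B → ℝ} (hf : ∀ y, 0 ≤ f y) (y : B) : (massMeasure f).real {y} = f y := by
  rw [measureReal_def, massMeasure, withDensity_apply _ (measurableSet_singleton y),
    lintegral_singleton, Measure.count_singleton, mul_one]
  simp [hf y]

theorem isProbabilityMeasure_massMeasure {B : Type*} [Fintype B] [MeasurableSpace B]
    [MeasurableSingletonClass B] {f : B → ℝ} (hf : ∀ y, 0 ≤ f y) (h1 : ∑ y, f y = 1) :
    IsProbabilityMeasure (massMeasure f) := by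
  refine ⟨?_⟩
  rw [massMeasure, withDensity_apply _ MeasurableSet.univ, Measure.restrict_univ,
    lintegral_count, tsum_fintype]
  change ∑ y, ENNReal.ofReal (f y) = 1
  rw [← ENNReal.ofReal_sum_of_nonneg fun y _ => hf y, h1, ENNReal.ofReal_one]

namespace Mechanism

variable {X : Type v}

open Classical in
/-- Generalized random response, applied to the bit that tells whether the dataset is `x₀`. -/
noncomputable def grr (x₀ : X) {ε t : ℝ} (ht : t ∈ Set.Icc 0 ε) : Mechanism.{u} X where
  Out := ULift.{u} Bool
  law x := if x = x₀ then massMeasure fun y => grrMass ε t y * grrRatio ε t y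
    else massMeasure (grrMass ε t)
  isProb x := by
    split_ifs
    · exact isProbabilityMeasure_massMeasure
        (fun y => mul_nonneg (grrMass_nonneg ht y) (grrRatio_pos ε t y).le)
        (sum_grrMass_mul_grrRatio ht)
    · exact isProbabilityMeasure_massMeasure (grrMass_nonneg ht) (sum_grrMass ε t)

theorem isBR_grr (nbr : X → X → Prop) (x₀ : X) {ε t : ℝ} (ht : t ∈ Set.Icc 0 ε) :
    (grr.{u} x₀ ht).IsBR nbr ε := by
  classical
  intro x x' _
  set w : X → ULift.{u} Bool → ℝ := fun x y =>
    grrMass ε t y * if x = x₀ then grrRatio ε t y else 1 with hw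
  have hw0 : ∀ x y, 0 ≤ w x y := fun x y => mul_nonneg (grrMass_nonneg ht y) (by
    split_ifs
    · exact (grrRatio_pos ε t y).le
    · exact zero_le_one)
  have hlaw : ∀ x, (grr.{u} x₀ ht).law x = massMeasure (w x) := by
    intro x
    by_cases h : x = x₀ <;> simp [grr, hw, h] <;> rfl
  have hdens : ∀ y₁ y₂, ((w x y₁).toNNReal : ℝ) * (w x' y₂).toNNReal ≤
      Real.exp ε * ((w x y₂).toNNReal * (w x' y₁).toNNReal) := by
    intro y₁ y₂
    have hε := ht.1.trans ht.2
    rw [Real.coe_toNNReal _ (hw0 _ _), Real.coe_toNNReal _ (hw0 _ _),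
      Real.coe_toNNReal _ (hw0 _ _), Real.coe_toNNReal _ (hw0 _ _)]
    have h1 : 1 ≤ Real.exp ε := Real.one_le_exp hε
    have h2 := grrRatio_le ε t hε y₁ y₂
    have h3 := grrRatio_le ε t hε y₂ y₁
    have h4 := mul_nonneg (grrMass_nonneg ht y₁) (grrMass_nonneg ht y₂)
    have h5 := mul_nonneg (grrRatio_pos ε t y₁).le (grrRatio_pos ε t y₂).le
    simp only [hw]
    split_ifs
    · nlinarith [mul_le_mul_of_nonneg_left h1 (mul_nonneg h4 h5)]
    · nlinarith [mul_le_mul_of_nonneg_left h2 h4]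
    · nlinarith [mul_le_mul_of_nonneg_left h3 h4]
    · nlinarith [mul_le_mul_of_nonneg_left h1 h4]
  have hcount : SigmaFinite (Measure.count : Measure (ULift.{u} Bool)) := inferInstance
  have hmeas : ∀ x, Measurable fun y => (w x y).toNNReal := fun x => measurable_of_finite _
  exact ⟨(Measure.count : Measure (ULift.{u} Bool)), fun y => (w x y).toNNReal,
    fun y => (w x' y).toNNReal, hcount, hmeas x, hmeas x', hlaw x, hlaw x', hdens⟩

theorem binomialDelta_le_deltaOpt_prod_grr {nbr : X → X → Prop} {x₀ x₁ : X} (hne : x₀ ≠ x₁)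
    (hx : nbr x₀ x₁) (k : ℕ) {ε t : ℝ} (ht : t ∈ Set.Icc 0 ε) (εg : ℝ) :
    binomialDelta k ε εg t ≤ (prod fun _ : Fin k => grr.{u} x₀ ht).deltaOpt nbr εg := by
  refine (isGLB_deltaOpt ⟨x₀, x₁, hx⟩ _ εg).2 fun δ hδ => ?_
  set P : Measure (ULift.{u} Bool) := massMeasure fun y => grrMass ε t y * grrRatio ε t y with hP
  set Q : Measure (ULift.{u} Bool) := massMeasure (grrMass ε t) with hQ
  have hP0 : (grr.{u} x₀ ht).law x₀ = P := if_pos rfl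
  have hQ0 : (grr.{u} x₀ ht).law x₁ = Q := if_neg hne.symm
  have iP : IsProbabilityMeasure P := hP0 ▸ (grr.{u} x₀ ht).isProb x₀
  have iQ : IsProbabilityMeasure Q := hQ0 ▸ (grr.{u} x₀ ht).isProb x₁
  obtain ⟨S, hS, hSeq⟩ := exists_pi_sub_eq_sum_max P Q k (Real.exp εg)
  have hdp : (Measure.pi fun _ : Fin k => (grr.{u} x₀ ht).law x₀).real S ≤
      Real.exp εg * (Measure.pi fun _ : Fin k => (grr.{u} x₀ ht).law x₁).real S + δ :=
    hδ x₀ x₁ hx S hS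
  rw [hP0, hQ0] at hdp
  replace hdp : (Measure.pi fun _ : Fin k => P).real S ≤
      Real.exp εg * (Measure.pi fun _ : Fin k => Q).real S + δ := hdp
  have hval : binomialDelta k ε εg t =
      ∑ y : Fin k → ULift.{u} Bool, max ((∏ i, P.real {y i}) -
        Real.exp εg * ∏ i, Q.real {y i}) 0 := by
    have hop : grrStep ε t = fun (ψ : ℝ → ℝ) x =>
        ∑ y : ULift.{u} Bool, grrMass ε t y * ψ (x * grrRatio ε t y) :=
      funext fun ψ => funext fun x => grrStep_eq_sum ε t ψ x
    rw [binomialDelta_eq_iterate, hop, ← sum_prod_mul_eq_iterate]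
    refine Finset.sum_congr rfl fun y _ => ?_
    simp only [hP, hQ, massMeasure_real_singleton (grrMass_nonneg ht),
      massMeasure_real_singleton (f := fun y => grrMass ε t y * grrRatio ε t y)
        fun y => mul_nonneg (grrMass_nonneg ht y) (grrRatio_pos ε t y).le]
    -- The mass under the second input is pulled out of the maximum, leaving the likelihood ratio
    -- inside.
    rw [← mul_zero (∏ i, grrMass ε t (y i)),
      mul_max_of_nonneg _ _ (Finset.prod_nonneg fun i _ => grrMass_nonneg ht (y i)),
      Finset.prod_mul_distrib, mul_zero]
    ring_nf
  linarith

theorem deltaOptClass_nonadaptiveBR {nbr : X → X → Prop} (hnbr : ∃ x x', x ≠ x' ∧ nbr x x')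
    (k : ℕ) {ε : ℝ} (hε : 0 ≤ ε) (εg : ℝ) :
    deltaOptClass nbr (nonadaptiveBR.{u} nbr k ε) εg =
      (Finset.range (k + 1)).sup' Finset.nonempty_range_add_one
        fun ℓ => binomialDelta k ε εg (tStar k ε εg ℓ) := by
  obtain ⟨x₀, x₁, hne, hx⟩ := hnbr
  have hlub := isLUB_deltaOptClass.{u} ⟨x₀, x₁, hx⟩ k hε εg
  refine le_antisymm (hlub.2 ?_) (Finset.sup'_le _ _ fun ℓ _ => ?_)
  · rintro _ ⟨_, ⟨N, hN, rfl⟩, rfl⟩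
    exact deltaOpt_prod_le ⟨x₀, x₁, hx⟩ hε εg hN
  · exact (binomialDelta_le_deltaOpt_prod_grr hne hx k (tStar_mem k hε εg ℓ) εg).trans
      (hlub.1 ⟨_, ⟨_, fun _ => isBR_grr nbr x₀ _, rfl⟩, rfl⟩)

end Mechanism

/-! ## A quadratic-time program -/

namespace RealProg

/-- Started with register contents `s`, the program `c` halts after at most `n` steps, with
register contents that satisfy `Q`. -/
def Halts (c : RealProg) (s : ℕ → ℝ) (n : ℕ) (Q : (ℕ → ℝ) → Prop) : Prop :=
  ∃ s' m, Runs c s s' m ∧ m ≤ n ∧ Q s'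

namespace Halts

variable {c d : RealProg} {s : ℕ → ℝ} {m n : ℕ} {Q R : (ℕ → ℝ) → Prop} {r a b x y : ℕ}

theorem of_runs {s' : ℕ → ℝ} (h : Runs c s s' m) (hmn : m ≤ n) (hQ : Q s') : Halts c s n Q :=
  ⟨s', m, h, hmn, hQ⟩

theorem seq {N : ℕ} (hc : Halts c s m R) (hd : ∀ s', R s' → Halts d s' n Q)
    (hN : m + n ≤ N) : Halts (.seq c d) s N Q := by
  obtain ⟨s', l, hr, hl, hs⟩ := hc
  obtain ⟨s'', l', hr', hl', hs'⟩ := hd s' hs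
  exact ⟨s'', l + l', hr.seq hr', (add_le_add hl hl').trans hN, hs'⟩

theorem runs_seq {s' : ℕ → ℝ} (h : Runs c s s' m) (hd : Halts d s' n Q) :
    Halts (.seq c d) s (n + m) Q := by
  obtain ⟨s'', l, hr, hl, hs⟩ := hd
  exact ⟨s'', m + l, h.seq hr, by omega, hs⟩

theorem const_seq {z : ℤ} (h : Halts d (Function.update s r (z : ℝ)) n Q) :
    Halts (.seq (.const r z) d) s (n + 1) Q := runs_seq (.const ..) h

theorem add_seq (h : Halts d (Function.update s r (s a + s b)) n Q) :
    Halts (.seq (.add r a b) d) s (n + 1) Q := runs_seq (.add ..) h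

theorem sub_seq (h : Halts d (Function.update s r (s a - s b)) n Q) :
    Halts (.seq (.sub r a b) d) s (n + 1) Q := runs_seq (.sub ..) h

theorem mul_seq (h : Halts d (Function.update s r (s a * s b)) n Q) :
    Halts (.seq (.mul r a b) d) s (n + 1) Q := runs_seq (.mul ..) h

theorem div_seq (hb : s b ≠ 0) (h : Halts d (Function.update s r (s a / s b)) n Q) :
    Halts (.seq (.div r a b) d) s (n + 1) Q := runs_seq (.div _ _ _ _ hb) h

theorem exp_seq (h : Halts d (Function.update s r (Real.exp (s a))) n Q) :
    Halts (.seq (.exp r a) d) s (n + 1) Q := runs_seq (.exp ..) h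

theorem select_seq (h : Halts d (Function.update s r (if s a ≤ s b then s x else s y)) n Q) :
    Halts (.seq (.ifLe a b (.copy r x) (.copy r y)) d) s (n + 2) Q := by
  refine runs_seq (m := 2) ?_ h
  split_ifs with hab
  · exact .ifTrue hab (.copy ..)
  · exact .ifFalse hab (.copy ..)

/-- Loop rule with an invariant indexed by the round: each of the `N` rounds pays for one test and
its body, and the last failing test adds 1. -/
theorem whileLe (I : ℕ → (ℕ → ℝ) → Prop) (N : ℕ)
    (hbody : ∀ i < N, ∀ s, I i s → s a ≤ s b ∧ Halts c s n (I (i + 1)))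
    (hend : ∀ s, I N s → ¬ s a ≤ s b) (h0 : I 0 s) :
    Halts (.whileLe a b c) s (N * (n + 1) + 1) (I N) := by
  suffices h : ∀ j i, i + j = N → ∀ s, I i s → Halts (.whileLe a b c) s (j * (n + 1) + 1) (I N) from
    h N 0 (zero_add N) s h0
  intro j
  induction j with
  | zero =>
    rintro i rfl s hs
    exact ⟨s, 1, .whileFalse (hend s hs), by omega, hs⟩
  | succ j ih =>
    intro i hi s hs
    obtain ⟨hle, s', l, hr, hl, hs'⟩ := hbody i (by omega) s hs
    obtain ⟨s'', l', hr', hl', hs''⟩ := ih (i + 1) (by omega) s' hs'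
    exact ⟨s'', l + l' + 1, .whileTrue hle hr hr', by rw [Nat.succ_mul]; omega, hs''⟩

end Halts

/-- One step of the Horner scheme for the binomial sum. Registers: `k` in 0, `ε` in 1, the
constants `1`, `exp εg`, `0` in 5, 6, 9, and `p`, `1 - p` in 11, 12; the index `i` in 13, the weight
`C(k,i) (1-p)^i` in 14, the partial sum in 15 and `k t - i ε` in 19. -/
def hornerStep : RealProg :=
  .seq (.exp 16 19) <| .seq (.sub 16 16 6) <| .seq (.ifLe 16 9 (.copy 16 9) (.copy 16 16)) <|
  .seq (.mul 16 16 14) <| .seq (.mul 15 15 11) <| .seq (.add 15 15 16) <|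
  .seq (.sub 16 0 13) <| .seq (.mul 14 14 16) <| .seq (.mul 14 14 12) <|
  .seq (.add 13 13 5) <| .seq (.div 14 14 13) <| .sub 19 19 1

/-- Puts `grrP ε t` into register 11, for `ε` in 1, `t` in 10, `1 - exp (-ε)` in 8. -/
def computeGrrP : RealProg :=
  .ifLe 1 9 (.copy 11 5) <|
    .seq (.sub 11 9 10) <| .seq (.exp 11 11) <| .seq (.sub 11 11 7) <| .div 11 11 8

/-- The candidate number `ℓ` (in register 3): updates the maximum in register 4. -/
def candidateStep : RealProg :=
  .seq (.add 16 3 5) <| .seq (.mul 16 16 1) <| .seq (.add 16 2 16) <| .seq (.div 16 16 18) <|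
  .seq (.ifLe 1 16 (.copy 10 1) (.copy 10 16)) <| .seq (.ifLe 9 10 (.copy 10 10) (.copy 10 9)) <|
  .seq computeGrrP <| .seq (.sub 12 5 11) <| .seq (.const 13 0) <| .seq (.const 14 1) <|
  .seq (.const 15 0) <| .seq (.mul 19 0 10) <| .seq (.whileLe 13 0 hornerStep) <|
  .seq (.ifLe 4 15 (.copy 4 15) (.copy 4 4)) <| .add 3 3 5

/-- Computes the optimal privacy parameter of the composition from `k`, `ε`, `εg`. -/
def optimalDelta : RealProg :=
  .seq (.const 5 1) <| .seq (.const 9 0) <| .seq (.const 3 0) <| .seq (.const 4 0) <|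
  .seq (.exp 6 2) <| .seq (.sub 7 9 1) <| .seq (.exp 7 7) <| .seq (.sub 8 5 7) <|
  .seq (.add 18 0 5) <| .seq (.whileLe 3 0 candidateStep) <| .copy 0 4

/-- The contents of the registers that are constant throughout the main loop. -/
structure Params (k : ℕ) (ε εg : ℝ) (s : ℕ → ℝ) : Prop where
  h0 : s 0 = k
  h1 : s 1 = ε
  h2 : s 2 = εg
  h5 : s 5 = 1
  h6 : s 6 = Real.exp εg
  h7 : s 7 = Real.exp (-ε)
  h8 : s 8 = 1 - Real.exp (-ε)
  h9 : s 9 = 0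
  h18 : s 18 = k + 1

/-- The partial sums of the Horner scheme. -/
noncomputable def hornerSum (k : ℕ) (ε εg t : ℝ) (i : ℕ) : ℝ :=
  ∑ j ∈ Finset.range i, (k.choose j : ℝ) * grrP ε t ^ (i - 1 - j) * (1 - grrP ε t) ^ j *
    max (Real.exp (k * t - j * ε) - Real.exp εg) 0

/-- Powers of `p` arise from one multiplication per round. No division by `p` is needed, which
matters since `p = 0` at `t = ε > 0`. -/
theorem hornerSum_succ (k : ℕ) (ε εg t : ℝ) (i : ℕ) :
    hornerSum k ε εg t (i + 1) = hornerSum k ε εg t i * grrP ε t +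
      max (Real.exp (k * t - i * ε) - Real.exp εg) 0 * (k.choose i * (1 - grrP ε t) ^ i) := by
  rw [hornerSum, Finset.sum_range_succ, hornerSum, Finset.sum_mul]
  congr 1
  · refine Finset.sum_congr rfl fun j hj => ?_
    have hj' := Finset.mem_range.1 hj
    rw [show i + 1 - 1 - j = i - 1 - j + 1 by omega, pow_succ]
    ring
  · simp
    ring

/-- The invariant of the inner loop. -/
structure InnerInv (k : ℕ) (ε εg : ℝ) (ℓ : ℕ) (best t : ℝ) (i : ℕ) (s : ℕ → ℝ) : Prop where
  params : Params k ε εg s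
  h3 : s 3 = ℓ
  h4 : s 4 = best
  h11 : s 11 = grrP ε t
  h12 : s 12 = 1 - grrP ε t
  h13 : s 13 = i
  h14 : s 14 = k.choose i * (1 - grrP ε t) ^ i
  h15 : s 15 = hornerSum k ε εg t i
  h19 : s 19 = k * t - i * ε

theorem choose_succ_cast {k i : ℕ} (hi : i ≤ k) :
    ((k.choose (i + 1) : ℕ) : ℝ) = k.choose i * (k - i) / (i + 1) := by
  have h := Nat.choose_succ_right_eq k i
  have h' : (k.choose (i + 1) : ℝ) * (i + 1) = k.choose i * (k - i) := by
    rw [← Nat.cast_sub hi]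
    exact_mod_cast h
  rw [← h']
  field_simp

theorem halts_hornerStep {k : ℕ} {ε εg : ℝ} {ℓ : ℕ} {best t : ℝ} {i : ℕ} (hi : i ≤ k)
    {s : ℕ → ℝ} (h : InnerInv k ε εg ℓ best t i s) :
    Halts hornerStep s 13 (InnerInv k ε εg ℓ best t (i + 1)) := by
  obtain ⟨⟨h0, h1, h2, h5, h6, h7, h8, h9, h18⟩, h3, h4, h11, h12, h13, h14, h15, h19⟩ := h
  have hi1 : (i : ℝ) + 1 ≠ 0 := by positivity
  refine .exp_seq <| .sub_seq <| .select_seq <| .mul_seq <| .mul_seq <| .add_seq <| .sub_seq <|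
    .mul_seq <| .mul_seq <| .add_seq <| .div_seq ?_ <| .of_runs (.sub ..) le_rfl ?_
  · simpa [h13, h5] using hi1
  · refine ⟨⟨?_, ?_, ?_, ?_, ?_, ?_, ?_, ?_, ?_⟩, ?_, ?_, ?_, ?_, ?_, ?_, ?_, ?_⟩
    all_goals simp [h0, h1, h2, h3, h4, h5, h6, h7, h8, h9, h11, h12, h13, h14, h15, h18, h19]
    · rw [choose_succ_cast hi, pow_succ]
      field_simp
    · rw [hornerSum_succ]
      congr 1
      split_ifs with hle
      · rw [max_eq_right (sub_nonpos.2 (Real.exp_le_exp.2 (by linarith))), zero_mul]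
      · rw [max_eq_left (sub_nonneg.2 (Real.exp_le_exp.2 (by linarith)))]
    · ring

theorem runs_computeGrrP {k : ℕ} {ε εg t : ℝ} (hε : 0 ≤ ε) {s : ℕ → ℝ} (h : Params k ε εg s)
    (ht : s 10 = t) :
    Halts computeGrrP s 5 fun s' => s' = Function.update s 11 (grrP ε t) := by
  obtain ⟨h0, h1, h2, h5, h6, h7, h8, h9, h18⟩ := h
  rcases hε.eq_or_lt with rfl | hpos
  -- The branch for `ε = 0` avoids the division by `1 - e^(-ε) = 0`, on which the machine would be
  -- stuck.
  · refine .of_runs (.ifTrue (by rw [h1, h9]) (.copy ..)) (by norm_num) ?_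
    simp [h5, grrP]
  · have hd : 1 - Real.exp (-ε) ≠ 0 := (one_sub_exp_neg_pos hpos).ne'
    refine .of_runs (.ifFalse (by rw [h1, h9]; exact not_le.2 hpos)
      (.seq (.sub ..) <| .seq (.exp ..) <| .seq (.sub ..) <| .div _ _ _ _ ?_)) (by norm_num) ?_
    · simpa [h8] using hd
    · simp [h7, h8, h9, ht, grrP_of_pos hpos]

/-- The running maximum over the candidates. -/
noncomputable def bestOf (k : ℕ) (ε εg : ℝ) : ℕ → ℝ
  | 0 => 0
  | ℓ + 1 => max (bestOf k ε εg ℓ) (binomialDelta k ε εg (tStar k ε εg ℓ))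

theorem bestOf_eq_sup' (k : ℕ) {ε : ℝ} (hε : 0 ≤ ε) (εg : ℝ) (n : ℕ) :
    bestOf k ε εg (n + 1) = (Finset.range (n + 1)).sup' Finset.nonempty_range_add_one
      fun ℓ => binomialDelta k ε εg (tStar k ε εg ℓ) := by
  induction n with
  -- Starting the maximum at `0` is harmless, since every candidate value is nonnegative.
  | zero => simpa [bestOf] using binomialDelta_nonneg k εg (tStar_mem k hε εg 0)
  | succ n ih =>
    rw [bestOf, ih]
    simp only [Finset.range_add_one (n := n + 1)]
    rw [Finset.sup'_insert, sup_comm]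

/-- The invariant of the outer loop. -/
structure OuterInv (k : ℕ) (ε εg : ℝ) (ℓ : ℕ) (s : ℕ → ℝ) : Prop where
  params : Params k ε εg s
  h3 : s 3 = ℓ
  h4 : s 4 = bestOf k ε εg ℓ

theorem halts_candidateStep {k : ℕ} {ε εg : ℝ} (hε : 0 ≤ ε) {ℓ : ℕ} {s : ℕ → ℝ}
    (h : OuterInv k ε εg ℓ s) :
    Halts candidateStep s (14 * (k + 1) + 22) (OuterInv k ε εg (ℓ + 1)) := by
  obtain ⟨⟨h0, h1, h2, h5, h6, h7, h8, h9, h18⟩, h3, h4⟩ := h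
  have hk1 : (k : ℝ) + 1 ≠ 0 := by positivity
  set t := tStar k ε εg ℓ with ht
  refine .add_seq <| .mul_seq <| .add_seq <| .div_seq ?_ <| .select_seq <| .select_seq <|
    .seq (runs_computeGrrP (k := k) (εg := εg) (t := t) hε ?_ ?_)
      (n := 14 * (k + 1) + 9) ?_ (by omega)
  · simpa [h18] using hk1
  · constructor <;> simp [h0, h1, h2, h5, h6, h7, h8, h9, h18]
  · simp [h1, h2, h3, h5, h9, h18, ht, tStar, max_def, min_def]
  · rintro _ rfl
    refine .sub_seq <| .const_seq <| .const_seq <| .const_seq <| .mul_seq <|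
      .seq (.whileLe (n := 13) (InnerInv k ε εg ℓ (bestOf k ε εg ℓ) t) (k + 1) ?_ ?_ ?_)
        (n := 3) ?_ (by omega)
    · intro i hi s' hs'
      refine ⟨?_, halts_hornerStep (Nat.lt_succ_iff.1 hi) hs'⟩
      rw [hs'.h13, hs'.params.h0]
      exact_mod_cast Nat.lt_succ_iff.1 hi
    · intro s' hs'
      rw [hs'.h13, hs'.params.h0, not_le]
      exact_mod_cast k.lt_succ_self
    · refine ⟨⟨?_, ?_, ?_, ?_, ?_, ?_, ?_, ?_, ?_⟩, ?_, ?_, ?_, ?_, ?_, ?_, ?_, ?_⟩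
      all_goals simp [h0, h1, h2, h3, h4, h5, h6, h7, h8, h9, h18, hornerSum]
      simp only [ht, tStar, max_def, min_def]
      split_ifs <;> simp
    · intro s' hs'
      obtain ⟨⟨h0, h1, h2, h5, h6, h7, h8, h9, h18⟩, h3, h4, -, -, -, -, h15, -⟩ := hs'
      have hsum : hornerSum k ε εg t (k + 1) = binomialDelta k ε εg t := by
        simp [hornerSum, binomialDelta]
      rw [hsum] at h15
      refine .select_seq <| .of_runs (.add ..) le_rfl ⟨⟨?_, ?_, ?_, ?_, ?_, ?_, ?_, ?_, ?_⟩, ?_, ?_⟩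
      all_goals simp [h0, h1, h2, h3, h4, h5, h6, h7, h8, h9, h15, h18, bestOf, max_def, ht]

theorem halts_optimalDelta (k : ℕ) {ε : ℝ} (hε : 0 ≤ ε) (εg : ℝ) :
    Halts optimalDelta (input k ε εg) ((k + 1) * (14 * (k + 1) + 23) + 11) fun s =>
      s 0 = (Finset.range (k + 1)).sup' Finset.nonempty_range_add_one
        fun ℓ => binomialDelta k ε εg (tStar k ε εg ℓ) := by
  refine .const_seq <| .const_seq <| .const_seq <| .const_seq <| .exp_seq <| .sub_seq <|
    .exp_seq <| .sub_seq <| .add_seq <|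
    .seq (.whileLe (n := 14 * (k + 1) + 22) (OuterInv k ε εg) (k + 1) ?_ ?_ ?_) (n := 1) ?_ (by ring_nf; omega)
  · intro ℓ hℓ s hs
    refine ⟨?_, halts_candidateStep hε hs⟩
    rw [hs.h3, hs.params.h0]
    exact_mod_cast Nat.lt_succ_iff.1 hℓ
  · intro s hs
    rw [hs.h3, hs.params.h0, not_le]
    exact_mod_cast k.lt_succ_self
  · refine ⟨⟨?_, ?_, ?_, ?_, ?_, ?_, ?_, ?_, ?_⟩, ?_, ?_⟩
    all_goals simp [input, bestOf]
  · intro s hs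
    refine .of_runs (.copy ..) le_rfl ?_
    rw [Function.update_self, hs.h4, bestOf_eq_sup' k hε]

end RealProg

theorem theorem3p2 :
    -- the optimal privacy parameter of the homogeneous nonadaptive composition
    (∀ (X : Type v) (nbr : X → X → Prop), (∃ x x' : X, x ≠ x' ∧ nbr x x') →
      ∀ (k : ℕ) (ε εg : ℝ), 0 ≤ ε →
        Mechanism.deltaOptClass nbr (Mechanism.nonadaptiveBR.{u} nbr k ε) εg =
          (Finset.range (k + 1)).sup' Finset.nonempty_range_add_one
            fun ℓ => binomialDelta k ε εg (tStar k ε εg ℓ)) ∧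
    -- one program computes this value for all inputs, in time quadratic in `k`
    (∃ (prog : RealProg) (C : ℕ), ∀ (k : ℕ) (ε εg : ℝ), 1 ≤ k → 0 ≤ ε →
      ∃ (s : ℕ → ℝ) (n : ℕ), RealProg.Runs prog (RealProg.input k ε εg) s n ∧
        s 0 = (Finset.range (k + 1)).sup' Finset.nonempty_range_add_one
          (fun ℓ => binomialDelta k ε εg (tStar k ε εg ℓ)) ∧
        n ≤ C * k ^ 2) := by
  refine ⟨fun X nbr hnbr k ε εg hε => Mechanism.deltaOptClass_nonadaptiveBR hnbr k hε εg,
    -- The step bound is `14 k² + 51 k + 48`, and `14 + 51 + 48 = 113`, so `k ≥ 1` suffices.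
    RealProg.optimalDelta, 113, fun k ε εg hk hε => ?_⟩
  obtain ⟨s, n, hr, hn, hs⟩ := RealProg.halts_optimalDelta k hε εg
  exact ⟨s, n, hr, hs, by nlinarith⟩
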